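/- Let $(\Omega,\mathcal F,\mathbb P)$ be a probability space, $\theta:\Omega\to\Omega$ an invertible, bi-measurable, measure-preserving and ergodic transformation, $d\in\mathbb N$, and let $\phi:\omega\mapsto\phi_\omega$ be a random quantum channel, i.e. a measurable map into the completely positive trace-preserving linear maps on $\mathbb M_d=M_d(\mathbb C)$. Put $\phi_{n;\omega}=\phi_{\theta^n(\omega)}$ for $n\in\mathbb Z$, and $\Phi_N=\phi_N\circ\cdots\circ\phi_1$ for $N>0$, $\Phi_N=\phi_0\circ\phi_{-1}\circ\cdots\circ\phi_N$ for $N\le 0$. Random matrices are identified when they agree almost surely, and $\langle A,B\rangle=\operatorname{Tr}(A^*B)$. A random orthogonal projection $P$ is called \emph{reducing} if there is a random constant $C>0$ such that, for every $N\ge 1$, $\Phi_N(P)\le C\,(P\circ\theta^N)$ almost surely. It is a \emph{minimal reducing projection} if it is a minimal element, for the almost sure order $\le$, of the set of reducing projections that are not almost surely $0$. Then the limit \[ \mathfrak E(I)=\lim_{M\to\infty}\frac1M\sum_{N=0}^{M-1}\Phi_{-N}(I) \] exists almost surely. Let $P_{\mathrm r}$ be the orthogonal projection onto the range of $\mathfrak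 E(I)$ (the \emph{recurrent projection}) and $P_{\mathrm t}=I-P_{\mathrm r}$ (the \emph{transient projection}). The following hold. (1) There are finitely many minimal reducing projections $Q_1,\dots,Q_m$ such that $Q_iQ_j=Q_jQ_i=0$ almost surely for all $i\ne j$ and $\sum_{i=1}^m Q_i=P_{\mathrm r}$ almost surely. (2) For every random matrix $Y$ with essentially bounded operator norm such that $P_{\mathrm t}YP_{\mathrm t}=Y$ almost surely, and for every random state $\vartheta$ (a random matrix with $\vartheta\ge 0$ and $\operatorname{Tr}\vartheta=1$ almost surely), \[ \lim_{M\to\infty}\frac1M\sum_{N=0}^{M-1}\mathbb E\big\langle\Phi_N(\vartheta),\,Y\circ\theta^{N}\big\rangle=0 . \] -/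

import Mathlib

open MeasureTheory Filter Topology
open scoped ENNReal MatrixOrder Matrix.Norms.L2Operator CStarAlgebra

noncomputable section

namespace RepeatedInteraction

/-- `d × d` complex matrices. In this file they carry the Loewner order and, as a norm, the operator
norm on `ℂ^d` (the topology is the usual one). -/
abbrev Mat (d : ℕ) : Type := Matrix (Fin d) (Fin d) ℂ

/-- A quantum channel: a completely positive, trace-preserving linear map on `d × d` matrices. -/
structure QuantumChannel (d : ℕ) extends CompletelyPositiveMap (Mat d) (Mat d) where
  trace_preserving : ∀ X : Mat d, (toLinearMap X).trace = X.trace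

/-- The Hilbert-Schmidt inner product `⟨A, B⟩ = Tr (A* B)`. -/
def hsInner {d : ℕ} (A B : Mat d) : ℂ := (Matrix.conjTranspose A * B).trace

/-- The orthogonal projection of `ℂ^d` onto the range of `A`, as a matrix. -/
def rangeProj {d : ℕ} (A : Mat d) : Mat d :=
  (Matrix.toEuclideanCLM (n := Fin d) (𝕜 := ℂ)).symm
    (LinearMap.range (Matrix.toEuclideanCLM (n := Fin d) (𝕜 := ℂ) A).toLinearMap).starProjection

/-- An ergodic repeated interaction quantum system: an invertible ergodic measure-preserving
transformation `θ` together with a random quantum channel `φ`. -/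
structure ERIS (Ω : Type*) [MeasurableSpace Ω] (μ : Measure Ω) (d : ℕ) where
  θ : Ω ≃ᵐ Ω
  ergodic : Ergodic θ μ
  φ : Ω → QuantumChannel d
  measurable_φ : ∀ X : Mat d, AEStronglyMeasurable (fun ω => (φ ω).toLinearMap X) μ

variable {Ω : Type*} [MeasurableSpace Ω] {μ : Measure Ω} {d : ℕ}

namespace ERIS

/-- The map `θ ^ n` for an integer `n`. -/
def shift (Q : ERIS Ω μ d) (n : ℤ) : Ω → Ω := ⇑((Q.θ.toEquiv : Equiv.Perm Ω) ^ n)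

/-- The random channel `φ_n = φ ∘ θ ^ n`, as a linear map. -/
def channel (Q : ERIS Ω μ d) (n : ℤ) (ω : Ω) : Mat d →ₗ[ℂ] Mat d :=
  (Q.φ (Q.shift n ω)).toLinearMap

/-- `φ_N ∘ ⋯ ∘ φ_1` (the identity for `N = 0`). -/
def forward (Q : ERIS Ω μ d) : ℕ → Ω → (Mat d →ₗ[ℂ] Mat d)
  | 0, _ => LinearMap.id
  | N + 1, ω => Q.channel (N + 1) ω ∘ₗ Q.forward N ω

/-- `φ_0 ∘ φ_{-1} ∘ ⋯ ∘ φ_{-N}`. -/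
def backward (Q : ERIS Ω μ d) : ℕ → Ω → (Mat d →ₗ[ℂ] Mat d)
  | 0, ω => Q.channel 0 ω
  | N + 1, ω => Q.backward N ω ∘ₗ Q.channel (-(N + 1)) ω

/-- `Φ_N = φ_N ∘ ⋯ ∘ φ_1` for `N > 0` and `Φ_N = φ_0 ∘ ⋯ ∘ φ_N` for `N ≤ 0`. -/
def Phi (Q : ERIS Ω μ d) (N : ℤ) (ω : Ω) : Mat d →ₗ[ℂ] Mat d :=
  if 0 < N then Q.forward N.toNat ω else Q.backward (-N).toNat ω

/-- The averages `(1/M) ∑_{N < M} Φ_{-N}(I)`. -/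
def cesaroAvgOne (Q : ERIS Ω μ d) (M : ℕ) (ω : Ω) : Mat d :=
  (M : ℝ)⁻¹ • ∑ N ∈ Finset.range M, Q.Phi (-(N : ℤ)) ω 1

/-- The pointwise limit `𝔈(I)` of the averages `(1/M) ∑_{N < M} Φ_{-N}(I)`. -/
def cesaroLimitOne (Q : ERIS Ω μ d) (ω : Ω) : Mat d :=
  limUnder atTop (fun M : ℕ => Q.cesaroAvgOne M ω)

/-- The recurrent projection, the range projection of `𝔈(I)`. -/
def recurrentProj (Q : ERIS Ω μ d) (ω : Ω) : Mat d := rangeProj (Q.cesaroLimitOne ω)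

/-- The transient projection. -/
def transientProj (Q : ERIS Ω μ d) (ω : Ω) : Mat d := 1 - Q.recurrentProj ω

end ERIS

/-- A random orthogonal projection. -/
def IsRandomProjection (μ : Measure Ω) (P : Ω → Mat d) : Prop :=
  AEStronglyMeasurable P μ ∧ ∀ᵐ ω ∂μ, IsStarProjection (P ω)

/-- A random state: almost surely positive of trace one. -/
def IsRandomState (μ : Measure Ω) (ϑ : Ω → Mat d) : Prop :=
  AEStronglyMeasurable ϑ μ ∧ ∀ᵐ ω ∂μ, 0 ≤ ϑ ω ∧ (ϑ ω).trace = 1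

/-- Membership in the corner `P 𝔄 P` of the algebra `𝔄` of random matrices with essentially bounded
operator norm. -/
def InCorner (μ : Measure Ω) (P Y : Ω → Mat d) : Prop :=
  MemLp Y ∞ μ ∧ ∀ᵐ ω ∂μ, P ω * Y ω * P ω = Y ω

/-- The random projection `P` reduces `Q`: there is a random constant `C > 0` such that, for all
`N ≥ 1`, `Φ_N(P) ≤ C (P ∘ θ ^ N)` almost surely. -/
def Reduces (Q : ERIS Ω μ d) (P : Ω → Mat d) : Prop :=
  IsRandomProjection μ P ∧
    ∃ C : Ω → ℝ, AEMeasurable C μ ∧ (∀ᵐ ω ∂μ, 0 < C ω) ∧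
      ∀ N : ℕ, 1 ≤ N → ∀ᵐ ω ∂μ, Q.Phi N ω (P ω) ≤ C ω • P (Q.shift N ω)

/-- `P` is a minimal element of the set of nonzero reducing projections; random matrices are
identified when they agree almost surely, and the order is the almost sure Loewner order. -/
def IsMinimalReducing (Q : ERIS Ω μ d) (P : Ω → Mat d) : Prop :=
  (Reduces Q P ∧ ¬ (∀ᵐ ω ∂μ, P ω = 0)) ∧
    ∀ P' : Ω → Mat d, Reduces Q P' → ¬ (∀ᵐ ω ∂μ, P' ω = 0) →
      (∀ᵐ ω ∂μ, P' ω ≤ P ω) → ∀ᵐ ω ∂μ, P' ω = P ω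

end RepeatedInteraction

end

/-!
Write `L` for the evolution `(L F) ω = φ_ω (F (θ⁻¹ ω))` of random matrices, so that
`Φ_{-N}(I) = L^{N+1} I` and `Φ_N(F) = (L^N F) ∘ θ^N`. The iterates of `L` are uniformly bounded
because the channels are positive and preserve the trace, and a noncommutative version of the
pointwise ergodic theorem (the mean ergodic theorem on `L²`, made pointwise by the maximal
inequality for `θ⁻¹`) gives `E = 𝔈(I)` with `L E = E`.

A random projection `P` is reducing iff every `φ_ω` maps the corner of `P ∘ θ⁻¹` into that of `P`.
The range projection of `E` is comparable to `E` pointwise, so it is reducing. If `R` is reducing,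
then `Tr (E (1 - R))` can only increase along `θ⁻¹` and hence, its integral being preserved, is
invariant: no mass flows from `1 - R` into `R` below the recurrent projection, and differences of
reducing projections are reducing there. By ergodicity a nonzero reducing projection is nonzero
almost everywhere, so the recurrent projection has at most `d` orthogonal reducing summands, and a
decomposition of maximal length consists of minimal ones.

Finally `Tr (L^N(ϑ) Y ∘ θ^N)` is dominated by the weight of `L^N I` in the transient corner, whose
averages tend to `E[Tr (E P_t)] = 0`.
-/

namespace RepeatedInteraction

section MaximalErgodic

variable {Ω : Type*}

theorem partialSups_birkhoffSum_nonneg (τ : Ω → Ω) (g : Ω → ℝ) (n : ℕ) (ω : Ω) :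
    0 ≤ partialSups (birkhoffSum τ g) n ω := by
  simpa only [birkhoffSum_zero] using le_partialSups_of_le (birkhoffSum τ g) n.zero_le ω

theorem partialSups_birkhoffSum_le_add {τ : Ω → Ω} {g : Ω → ℝ} {n : ℕ} {ω : Ω}
    (hω : 0 < partialSups (birkhoffSum τ g) n ω) :
    partialSups (birkhoffSum τ g) n ω ≤ g ω + partialSups (birkhoffSum τ g) n (τ ω) := by
  rw [Pi.partialSups_apply] at hω ⊢
  obtain ⟨k, hkn, hk⟩ := exists_partialSups_eq (fun i => birkhoffSum τ g i ω) n
  rw [hk] at hω ⊢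
  obtain _ | k := k
  · simp only [birkhoffSum_zero, lt_irrefl] at hω
  · rw [birkhoffSum_succ']
    gcongr
    exact le_partialSups_of_le (birkhoffSum τ g) (k.le_succ.trans hkn) (τ ω)

variable [MeasurableSpace Ω] {μ : Measure Ω} {τ : Ω → Ω}

theorem integral_comp_of_measurePreserving {E : Type*} [NormedAddCommGroup E] [NormedSpace ℝ E]
    (hτ : MeasurePreserving τ μ μ) {f : Ω → E} (hf : AEStronglyMeasurable f μ) :
    ∫ ω, f (τ ω) ∂μ = ∫ ω, f ω ∂μ := by
  rw [← integral_map hτ.aemeasurable (by rwa [hτ.map_eq]), hτ.map_eq]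

theorem integrable_birkhoffSum (hτ : MeasurePreserving τ μ μ) {g : Ω → ℝ} (hg : Integrable g μ)
    (n : ℕ) : Integrable (birkhoffSum τ g n) μ :=
  integrable_finsetSum _ fun k _ => (hτ.iterate k).integrable_comp_of_integrable hg

theorem integrable_partialSups_birkhoffSum (hτ : MeasurePreserving τ μ μ) {g : Ω → ℝ}
    (hg : Integrable g μ) (n : ℕ) : Integrable (partialSups (birkhoffSum τ g) n) μ := by
  induction n with
  | zero => simpa only [partialSups_zero] using integrable_birkhoffSum hτ hg 0
  | succ n ih =>
    simpa only [partialSups_add_one] using ih.sup (integrable_birkhoffSum hτ hg (n + 1))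

theorem setIntegral_partialSups_birkhoffSum_pos_nonneg (hτ : MeasurePreserving τ μ μ) {g : Ω → ℝ}
    (hg : Integrable g μ) (n : ℕ) :
    0 ≤ ∫ ω in {ω | 0 < partialSups (birkhoffSum τ g) n ω}, g ω ∂μ := by
  set m : Ω → ℝ := partialSups (birkhoffSum τ g) n
  set S : Set Ω := {ω | 0 < m ω}
  have hm : Integrable m μ := integrable_partialSups_birkhoffSum hτ hg n
  have hm0 : ∀ ω, 0 ≤ m ω := partialSups_birkhoffSum_nonneg τ g n
  have hmτ : Integrable (fun ω => m (τ ω)) μ := hτ.integrable_comp_of_integrable hm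
  have hS : NullMeasurableSet S μ := nullMeasurableSet_lt aemeasurable_const hm.aemeasurable
  calc
    0 = ∫ ω in S, m ω ∂μ - ∫ ω, m (τ ω) ∂μ := by
      rw [integral_comp_of_measurePreserving hτ hm.aestronglyMeasurable,
        setIntegral_eq_integral_of_forall_compl_eq_zero (s := S)
          fun ω hω => le_antisymm (not_lt.1 hω) (hm0 ω), sub_self]
    _ ≤ ∫ ω in S, m ω ∂μ - ∫ ω in S, m (τ ω) ∂μ :=
      sub_le_sub_left (setIntegral_le_integral hmτ (ae_of_all _ fun ω => hm0 (τ ω))) _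
    _ = ∫ ω in S, (m ω - m (τ ω)) ∂μ := (integral_sub hm.integrableOn hmτ.integrableOn).symm
    _ ≤ ∫ ω in S, g ω ∂μ :=
      setIntegral_mono_on₀ (hm.sub hmτ).integrableOn hg.integrableOn hS fun ω hω =>
        sub_le_iff_le_add.2 (partialSups_birkhoffSum_le_add hω)

theorem measure_exists_lt_birkhoffSum_le [IsFiniteMeasure μ] (hτ : MeasurePreserving τ μ μ)
    {f : Ω → ℝ} (hf : Integrable f μ) (hf0 : ∀ ω, 0 ≤ f ω) {c : ℝ} (hc : 0 < c) :
    μ {ω | ∃ n : ℕ, n * c < birkhoffSum τ f n ω} ≤ ENNReal.ofReal ((∫ ω, f ω ∂μ) / c) := by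
  set g : Ω → ℝ := fun ω => f ω - c
  have hg : Integrable g μ := hf.sub (integrable_const c)
  set S : ℕ → Set Ω := fun n => {ω | 0 < partialSups (birkhoffSum τ g) n ω}
  have hS_mono : Monotone S := fun _ _ hij ω (hω : 0 < _) =>
    hω.trans_le ((partialSups (birkhoffSum τ g)).monotone hij ω)
  have h_subset : {ω | ∃ n : ℕ, n * c < birkhoffSum τ f n ω} ⊆ ⋃ n, S n := by
    rintro ω ⟨n, hn⟩
    have h_sum : birkhoffSum τ g n ω = birkhoffSum τ f n ω - n * c := by
      simp only [birkhoffSum, g, Finset.sum_sub_distrib, Finset.sum_const, Finset.card_range,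
        nsmul_eq_mul]
    have h_pos : 0 < birkhoffSum τ g n ω := by linarith
    exact Set.mem_iUnion.2 ⟨n, h_pos.trans_le (le_partialSups (birkhoffSum τ g) n ω)⟩
  have h_measure (n : ℕ) : μ (S n) ≤ ENNReal.ofReal ((∫ ω, f ω ∂μ) / c) := by
    have h_sub : 0 ≤ (∫ ω in S n, f ω ∂μ) - μ.real (S n) * c := by
      simpa only [g, integral_sub hf.integrableOn (integrable_const c).integrableOn,
        setIntegral_const, smul_eq_mul] using
        setIntegral_partialSups_birkhoffSum_pos_nonneg hτ hg n
    rw [← ofReal_measureReal]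
    refine ENNReal.ofReal_le_ofReal ((le_div_iff₀ hc).2 ?_)
    linarith [setIntegral_le_integral (s := S n) hf (ae_of_all _ hf0)]
  calc μ {ω | ∃ n : ℕ, n * c < birkhoffSum τ f n ω} ≤ μ (⋃ n, S n) := measure_mono h_subset
    _ = ⨆ n, μ (S n) := hS_mono.measure_iUnion
    _ ≤ _ := iSup_le h_measure

end MaximalErgodic

section BirkhoffAverage

variable (𝕜 : Type*) {V W F G : Type*} [AddCommGroup V] [FunLike F V V] [AddMonoidHomClass F V V]

theorem birkhoffAverage_map_sub [DivisionRing 𝕜] [AddCommGroup W] [Module 𝕜 W] [FunLike G V W]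
    [AddMonoidHomClass G V W] (L : F) (g : G) (n : ℕ) (x y : V) :
    birkhoffAverage 𝕜 L g n (x - y) =
      birkhoffAverage 𝕜 L g n x - birkhoffAverage 𝕜 L g n y := by
  simp only [birkhoffAverage, birkhoffSum, iterate_map_sub, map_sub, Finset.sum_sub_distrib,
    smul_sub]

theorem tendsto_birkhoffAverage_sub_map [RCLike 𝕜] [NormedAddCommGroup W] [NormedSpace 𝕜 W]
    [FunLike G V W] [AddMonoidHomClass G V W] {L : F} {g : G} {x : V}
    (h : Bornology.IsBounded (Set.range fun n => g (L^[n] x))) :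
    Tendsto (birkhoffAverage 𝕜 L g · (x - L x)) atTop (𝓝 0) := by
  simpa only [birkhoffAverage_map_sub, neg_sub, neg_zero] using
    (tendsto_birkhoffAverage_apply_sub_birkhoffAverage 𝕜 h).neg

end BirkhoffAverage

section MeanErgodic

variable {𝕜 : Type*} [RCLike 𝕜]

section NormedSpace

variable {E : Type*} [NormedAddCommGroup E] [NormedSpace 𝕜 E] {L : E →L[𝕜] E} {K : ℝ}

theorem norm_iterate_apply_le (hL : ∀ n, ‖L ^ n‖ ≤ K) (n : ℕ) (x : E) :
    ‖L^[n] x‖ ≤ K * ‖x‖ :=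
  FunLike.coe_pow_eq_iterate L n ▸ (L ^ n).le_of_opNorm_le (hL n) x

theorem norm_sub_birkhoffAverage_le (hL : ∀ n, ‖L ^ n‖ ≤ K) {y : E} (hy : L y = y) (x : E)
    {n : ℕ} (hn : n ≠ 0) : ‖y - birkhoffAverage 𝕜 L id n x‖ ≤ K * ‖y - x‖ := by
  have hn' : (0 : ℝ) < n := by positivity
  have h_term (k : ℕ) : dist (L^[k] y) (L^[k] x) ≤ K * ‖y - x‖ := by
    rw [dist_eq_norm, ← iterate_map_sub]
    exact norm_iterate_apply_le hL k _
  calc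
    ‖y - birkhoffAverage 𝕜 L id n x‖
      = dist (birkhoffAverage 𝕜 L id n y) (birkhoffAverage 𝕜 L id n x) := by
        rw [Function.IsFixedPt.birkhoffAverage_eq 𝕜 hy id (Nat.cast_ne_zero.2 hn), dist_eq_norm, id]
    _ ≤ (∑ k ∈ Finset.range n, dist (L^[k] y) (L^[k] x)) / n :=
      dist_birkhoffAverage_birkhoffAverage_le 𝕜 L id n y x
    _ ≤ K * ‖y - x‖ := by
      rw [div_le_iff₀ hn']
      exact (Finset.sum_le_card_nsmul _ _ _ fun k _ => h_term k).trans_eq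
        (by rw [Finset.card_range, nsmul_eq_mul, mul_comm])

theorem tendsto_birkhoffAverage_one_sub (hL : ∀ n, ‖L ^ n‖ ≤ K) (w : E) :
    Tendsto (birkhoffAverage 𝕜 L id · ((1 - L : E →L[𝕜] E) w)) atTop (𝓝 0) :=
  tendsto_birkhoffAverage_sub_map 𝕜 (g := AddMonoidHom.id E) <|
    isBounded_iff_forall_norm_le.2
      ⟨K * ‖w‖, Set.forall_mem_range.2 fun n => norm_iterate_apply_le hL n w⟩

theorem eq_zero_of_map_eq_self_of_mem_closure_range (hL : ∀ n, ‖L ^ n‖ ≤ K) {y : E}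
    (hy : L y = y) (hy_mem : y ∈ (1 - L).range.topologicalClosure) : y = 0 := by
  have h_range : ∀ x ∈ (1 - L).range, ‖y‖ ≤ K * ‖y - x‖ := by
    rintro _ ⟨w, rfl⟩
    refine le_of_tendsto ?_
      ((eventually_ne_atTop 0).mono fun n hn => norm_sub_birkhoffAverage_le hL hy ((1 - L) w) hn)
    simpa only [sub_zero] using (tendsto_const_nhds.sub (tendsto_birkhoffAverage_one_sub hL w)).norm
  have h_closure : ‖y‖ ≤ K * ‖y - y‖ :=
    closure_minimal h_range
      (isClosed_le continuous_const ((continuous_const.sub continuous_id).norm.const_mul K)) hy_mem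
  simpa only [sub_self, norm_zero, mul_zero, norm_le_zero_iff] using h_closure

end NormedSpace

theorem dense_ker_sup_range_one_sub {H : Type*} [NormedAddCommGroup H] [InnerProductSpace 𝕜 H]
    [CompleteSpace H] {L : H →L[𝕜] H} {K : ℝ} (hL : ∀ n, ‖L ^ n‖ ≤ K) :
    Dense (((1 - L).ker ⊔ (1 - L).range : Submodule 𝕜 H) : Set H) := by
  rw [Submodule.dense_iff_topologicalClosure_eq_top, Submodule.topologicalClosure_eq_top_iff,
    ← Submodule.inf_orthogonal, ContinuousLinearMap.orthogonal_ker,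
    ContinuousLinearMap.orthogonal_range, Submodule.eq_bot_iff]
  have h_adjoint : ContinuousLinearMap.adjoint (1 - L) = 1 - ContinuousLinearMap.adjoint L := by
    simp only [← ContinuousLinearMap.star_eq_adjoint, star_sub, star_one]
  have hL' (n : ℕ) : ‖ContinuousLinearMap.adjoint L ^ n‖ ≤ K := by
    rw [← ContinuousLinearMap.star_eq_adjoint, ← star_pow, ContinuousLinearMap.star_eq_adjoint,
      LinearIsometryEquiv.norm_map]
    exact hL n
  rintro z ⟨hz_range, hz_fixed⟩
  rw [h_adjoint] at hz_range hz_fixed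
  exact eq_zero_of_map_eq_self_of_mem_closure_range hL' (sub_eq_zero.1 hz_fixed).symm hz_range

end MeanErgodic

section Cocycle

variable {Ω G : Type*} [Monoid G]

/-- The cocycle generated by `T` over `τ`: the product `T ω * T (τ ω) * ⋯ * T (τ^[n - 1] ω)`. -/
def cocycle (T : Ω → G) (τ : Ω → Ω) : ℕ → Ω → G
  | 0, _ => 1
  | n + 1, ω => T ω * cocycle T τ n (τ ω)

variable (T : Ω → G) (τ : Ω → Ω)

theorem cocycle_succ' (n : ℕ) (ω : Ω) :
    cocycle T τ (n + 1) ω = cocycle T τ n ω * T (τ^[n] ω) := by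
  induction n generalizing ω with
  | zero => simp only [cocycle, mul_one, one_mul, Function.iterate_zero, id]
  | succ n ih => rw [cocycle, ih, cocycle, mul_assoc, Function.iterate_succ_apply]

theorem map_cocycle {G' M : Type*} [Monoid G'] [FunLike M G G'] [MonoidHomClass M G G'] (f : M)
    (n : ℕ) (ω : Ω) : f (cocycle T τ n ω) = cocycle (fun ω => f (T ω)) τ n ω := by
  induction n generalizing ω with
  | zero => exact map_one f
  | succ n ih => rw [cocycle, cocycle, map_mul, ih]

end Cocycle

section Transfer

variable {𝕜 Ω E : Type*}

section Algebra

variable [Ring 𝕜] [AddCommGroup E] [Module 𝕜 E]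

/-- The transfer operator `F ↦ T · (F ∘ τ)` of the random linear map `T` over `τ`. -/
def transfer (T : Ω → Module.End 𝕜 E) (τ : Ω → Ω) : Module.End 𝕜 (Ω → E) where
  toFun F ω := T ω (F (τ ω))
  map_add' F G := funext fun ω => map_add (T ω) (F (τ ω)) (G (τ ω))
  map_smul' c F := funext fun ω => map_smul (T ω) c (F (τ ω))

theorem transfer_apply (T : Ω → Module.End 𝕜 E) (τ : Ω → Ω) (F : Ω → E) (ω : Ω) :
    transfer T τ F ω = T ω (F (τ ω)) := rfl

theorem transfer_iterate_apply (T : Ω → Module.End 𝕜 E) (τ : Ω → Ω) (n : ℕ) (F : Ω → E) (ω : Ω) :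
    (transfer T τ)^[n] F ω = cocycle T τ n ω (F (τ^[n] ω)) := by
  induction n generalizing ω with
  | zero => rfl
  | succ n ih =>
    rw [Function.iterate_succ_apply', transfer_apply, ih, cocycle, Module.End.mul_apply,
      Function.iterate_succ_apply]

theorem cocycle_conj_apply {E' : Type*} [AddCommGroup E'] [Module 𝕜 E'] (e : E ≃ₗ[𝕜] E')
    (T : Ω → Module.End 𝕜 E) (τ : Ω → Ω) (n : ℕ) (ω : Ω) (x : E') :
    cocycle (fun ω => e.conjRingEquiv (T ω)) τ n ω x = e (cocycle T τ n ω (e.symm x)) := by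
  rw [← map_cocycle]
  rfl

end Algebra

/-- The averages `M⁻¹ ∑_{n < M} (transfer T τ)^[n] F`. -/
def transferAverage [DivisionRing 𝕜] [AddCommGroup E] [Module 𝕜 E] (T : Ω → Module.End 𝕜 E)
    (τ : Ω → Ω) (M : ℕ) (F : Ω → E) : Ω → E :=
  birkhoffAverage 𝕜 (transfer T τ) id M F

section Algebra

variable [DivisionRing 𝕜] [AddCommGroup E] [Module 𝕜 E] (T : Ω → Module.End 𝕜 E) (τ : Ω → Ω)

theorem transferAverage_apply (M : ℕ) (F : Ω → E) (ω : Ω) :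
    transferAverage T τ M F ω = birkhoffAverage 𝕜 (transfer T τ) (LinearMap.proj (R := 𝕜) ω) M F :=
  map_birkhoffAverage 𝕜 𝕜 (LinearMap.proj (R := 𝕜) ω) (transfer T τ) id M F

theorem transferAverage_sub (M : ℕ) (F G : Ω → E) :
    transferAverage T τ M (F - G) = transferAverage T τ M F - transferAverage T τ M G :=
  birkhoffAverage_map_sub 𝕜 (transfer T τ) (AddMonoidHom.id (Ω → E)) M F G

theorem transferAverage_add (M : ℕ) (F G : Ω → E) :
    transferAverage T τ M (F + G) = transferAverage T τ M F + transferAverage T τ M G := by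
  rw [← sub_eq_iff_eq_add, ← transferAverage_sub, add_sub_cancel_right]

theorem transferAverage_conj_apply {E' : Type*} [AddCommGroup E'] [Module 𝕜 E'] (e : E ≃ₗ[𝕜] E')
    (M : ℕ) (F : Ω → E') (ω : Ω) :
    transferAverage (fun ω => e.conjRingEquiv (T ω)) τ M F ω =
      e (transferAverage T τ M (fun ω => e.symm (F ω)) ω) := by
  simp only [transferAverage_apply, birkhoffAverage, birkhoffSum, LinearMap.proj_apply,
    transfer_iterate_apply, cocycle_conj_apply, map_smul, map_sum]

end Algebra

section Measure

variable [MeasurableSpace Ω] {μ : Measure Ω} {τ : Ω → Ω}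

theorem ae_forall_transfer_iterate_congr [Ring 𝕜] [AddCommGroup E] [Module 𝕜 E]
    (T : Ω → Module.End 𝕜 E) (hτ : MeasurePreserving τ μ μ) {F G : Ω → E} (h : F =ᵐ[μ] G) :
    ∀ᵐ ω ∂μ, ∀ n, (transfer T τ)^[n] F ω = (transfer T τ)^[n] G ω := by
  filter_upwards [ae_all_iff.2 fun n => (hτ.iterate n).quasiMeasurePreserving.ae_eq_comp h]
    with ω hω n
  rw [transfer_iterate_apply, transfer_iterate_apply]
  exact congrArg _ (hω n)

theorem transfer_congr_ae [Ring 𝕜] [AddCommGroup E] [Module 𝕜 E] (T : Ω → Module.End 𝕜 E)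
    (hτ : MeasurePreserving τ μ μ) {F G : Ω → E} (h : F =ᵐ[μ] G) :
    transfer T τ F =ᵐ[μ] transfer T τ G :=
  (ae_forall_transfer_iterate_congr T hτ h).mono fun _ hω => hω 1

theorem ae_forall_transferAverage_congr [DivisionRing 𝕜] [AddCommGroup E] [Module 𝕜 E]
    (T : Ω → Module.End 𝕜 E) (hτ : MeasurePreserving τ μ μ) {F G : Ω → E} (h : F =ᵐ[μ] G) :
    ∀ᵐ ω ∂μ, ∀ M, transferAverage T τ M F ω = transferAverage T τ M G ω := by
  filter_upwards [ae_forall_transfer_iterate_congr T hτ h] with ω hω M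
  simp only [transferAverage_apply, birkhoffAverage, birkhoffSum, LinearMap.proj_apply, hω]

end Measure

section Norm

variable [RCLike 𝕜] [NormedAddCommGroup E] [NormedSpace 𝕜 E] {T : Ω → Module.End 𝕜 E} {τ : Ω → Ω}
  {K : ℝ}

theorem norm_transfer_iterate_le (hK : ∀ n ω x, ‖cocycle T τ n ω x‖ ≤ K * ‖x‖) (n : ℕ)
    (F : Ω → E) (ω : Ω) : ‖(transfer T τ)^[n] F ω‖ ≤ K * ‖F (τ^[n] ω)‖ :=
  transfer_iterate_apply T τ n F ω ▸ hK n ω _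

theorem norm_transferAverage_le (hK : ∀ n ω x, ‖cocycle T τ n ω x‖ ≤ K * ‖x‖) (M : ℕ)
    (F : Ω → E) (ω : Ω) :
    ‖transferAverage T τ M F ω‖ ≤ (M : ℝ)⁻¹ * (K * birkhoffSum τ (fun ω => ‖F ω‖) M ω) := by
  rw [transferAverage_apply, birkhoffAverage, norm_smul, norm_inv, RCLike.norm_natCast,
    birkhoffSum, birkhoffSum, Finset.mul_sum]
  gcongr
  exact norm_sum_le_of_le _ fun n _ => norm_transfer_iterate_le hK n F ω

theorem tendsto_transferAverage_sub_transfer (hK : ∀ n ω x, ‖cocycle T τ n ω x‖ ≤ K * ‖x‖)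
    {Z : Ω → E} {C : ℝ} (hZ : ∀ ω, ‖Z ω‖ ≤ C) (ω : Ω) :
    Tendsto (fun M => transferAverage T τ M (Z - transfer T τ Z) ω) atTop (𝓝 0) := by
  simp only [transferAverage_apply]
  refine tendsto_birkhoffAverage_sub_map 𝕜 (isBounded_iff_forall_norm_le.2 ⟨|K| * C, ?_⟩)
  rintro _ ⟨n, rfl⟩
  calc ‖(transfer T τ)^[n] Z ω‖ ≤ K * ‖Z (τ^[n] ω)‖ := norm_transfer_iterate_le hK n Z ω
    _ ≤ |K| * C := mul_le_mul (le_abs_self K) (hZ _) (norm_nonneg _) (abs_nonneg K)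

end Norm

section Stationary

variable [RCLike 𝕜] [NormedAddCommGroup E] [NormedSpace 𝕜 E] [FiniteDimensional 𝕜 E]
  [MeasurableSpace Ω] {μ : Measure Ω} {T : Ω → Module.End 𝕜 E} {τ : Ω → Ω} {K : ℝ}

theorem transfer_ae_eq_self_of_tendsto (hτ : MeasurePreserving τ μ μ)
    (hK : ∀ n ω x, ‖cocycle T τ n ω x‖ ≤ K * ‖x‖) {F y : Ω → E} {C : ℝ} (hF : ∀ ω, ‖F ω‖ ≤ C)
    (hy : ∀ᵐ ω ∂μ, Tendsto (fun M => transferAverage T τ M F ω) atTop (𝓝 (y ω))) :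
    transfer T τ y =ᵐ[μ] y := by
  filter_upwards [hy, hτ.quasiMeasurePreserving.ae hy] with ω hω hτω
  have h_map (M : ℕ) :
      transferAverage T τ M (transfer T τ F) ω = T ω (transferAverage T τ M F (τ ω)) := by
    rw [← transfer_apply, transferAverage, transferAverage,
      map_birkhoffAverage 𝕜 𝕜 (transfer T τ)]
    simp only [birkhoffAverage, birkhoffSum, Function.comp_apply, id,
      ← Function.iterate_succ_apply, ← Function.iterate_succ_apply']
  have h_lim : Tendsto (fun M => transferAverage T τ M (transfer T τ F) ω) atTop
      (𝓝 (T ω (y (τ ω)))) := by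
    simp only [h_map]
    exact ((T ω).continuous_of_finiteDimensional.tendsto _).comp hτω
  refine (sub_eq_zero.1 (tendsto_nhds_unique (hω.sub h_lim) ?_)).symm
  simpa only [← Pi.sub_apply, ← transferAverage_sub] using
    tendsto_transferAverage_sub_transfer hK hF ω

end Stationary

end Transfer

section PointwiseErgodic

variable {𝕜 Ω E : Type*} [RCLike 𝕜] [NormedAddCommGroup E] [NormedSpace 𝕜 E] [MeasurableSpace Ω]
  {μ : Measure Ω} {T : Ω → Module.End 𝕜 E} {τ : Ω → Ω} {K : ℝ}

/-- Almost sure convergence of the averages of `F` under the transfer operator of `T` over `τ`. -/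
def AEConvergentAverage (μ : Measure Ω) (T : Ω → Module.End 𝕜 E) (τ : Ω → Ω) (F : Ω → E) : Prop :=
  ∀ᵐ ω ∂μ, ∃ y, Tendsto (fun M => transferAverage T τ M F ω) atTop (𝓝 y)

theorem AEConvergentAverage.congr_ae (hτ : MeasurePreserving τ μ μ) {F G : Ω → E}
    (hF : AEConvergentAverage μ T τ F) (h : F =ᵐ[μ] G) : AEConvergentAverage μ T τ G := by
  filter_upwards [hF, ae_forall_transferAverage_congr T hτ h] with ω hω h_eq
  simpa only [h_eq] using hω

theorem AEConvergentAverage.add {F G : Ω → E} (hF : AEConvergentAverage μ T τ F)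
    (hG : AEConvergentAverage μ T τ G) : AEConvergentAverage μ T τ (F + G) := by
  filter_upwards [hF, hG] with ω ⟨y, hy⟩ ⟨z, hz⟩
  exact ⟨y + z, by simpa only [transferAverage_add] using! hy.add hz⟩

theorem exists_tendsto_of_forall_eventually_norm_sub_le [CompleteSpace E] {a : ℕ → E}
    (h : ∀ c > 0, ∃ y, ∀ᶠ M in atTop, ‖a M - y‖ ≤ c) : ∃ y, Tendsto a atTop (𝓝 y) := by
  refine cauchySeq_tendsto_of_complete (Metric.cauchySeq_iff'.2 fun ε hε => ?_)
  obtain ⟨y, hy⟩ := h (ε / 3) (by positivity)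
  obtain ⟨N, hN⟩ := eventually_atTop.1 hy
  refine ⟨N, fun n hn => (dist_triangle_right (a n) (a N) y).trans_lt ?_⟩
  rw [dist_eq_norm, dist_eq_norm]
  linarith [hN n hn, hN N le_rfl]

theorem measure_not_exists_eventually_norm_sub_le [IsFiniteMeasure μ]
    (hτ : MeasurePreserving τ μ μ) (hK : ∀ n ω x, ‖cocycle T τ n ω x‖ ≤ K * ‖x‖) (hK0 : 0 < K)
    {F G : Ω → E} (hFG : Integrable (F - G) μ) (hG : AEConvergentAverage μ T τ G) {c : ℝ}
    (hc : 0 < c) :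
    μ {ω | ¬∃ y, ∀ᶠ M in atTop, ‖transferAverage T τ M F ω - y‖ ≤ c} ≤
      ENNReal.ofReal ((∫ ω, ‖(F - G) ω‖ ∂μ) / (c / (2 * K))) := by
  refine (measure_mono_ae ?_).trans (measure_exists_lt_birkhoffSum_le hτ hFG.norm
    (fun ω => norm_nonneg _) (by positivity))
  filter_upwards [hG] with ω ⟨y, hy⟩ h_bad
  by_contra h_small
  refine h_bad ⟨y, ?_⟩
  filter_upwards [Metric.tendsto_nhds.1 hy (c / 2) (half_pos hc), eventually_gt_atTop 0]
    with M hM hM0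
  have hM0' : (0 : ℝ) < M := by exact_mod_cast hM0
  have h_sum : birkhoffSum τ (fun ω => ‖(F - G) ω‖) M ω ≤ M * (c / (2 * K)) :=
    not_lt.1 fun h => h_small ⟨M, h⟩
  have h_avg : ‖transferAverage T τ M (F - G) ω‖ ≤ c / 2 :=
    calc ‖transferAverage T τ M (F - G) ω‖
        ≤ (M : ℝ)⁻¹ * (K * birkhoffSum τ (fun ω => ‖(F - G) ω‖) M ω) :=
          norm_transferAverage_le hK M (F - G) ω
      _ ≤ (M : ℝ)⁻¹ * (K * (M * (c / (2 * K)))) := by gcongr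
      _ = c / 2 := by field_simp
  rw [dist_eq_norm] at hM
  calc ‖transferAverage T τ M F ω - y‖
      = ‖transferAverage T τ M (F - G) ω + (transferAverage T τ M G ω - y)‖ := by
        rw [transferAverage_sub, Pi.sub_apply, sub_add_sub_cancel]
    _ ≤ c / 2 + c / 2 := (norm_add_le _ _).trans (add_le_add h_avg hM.le)
    _ = c := add_halves c

theorem integral_norm_sub_le_dist [IsProbabilityMeasure μ] {p : ℝ≥0∞} [Fact (1 ≤ p)]
    (F G : Lp E p μ) : ∫ ω, ‖(F - G : Ω → E) ω‖ ∂μ ≤ dist F G := by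
  have h_meas : AEStronglyMeasurable (F - G : Ω → E) μ :=
    (Lp.aestronglyMeasurable F).sub (Lp.aestronglyMeasurable G)
  rw [integral_norm_eq_lintegral_enorm h_meas, ← eLpNorm_one_eq_lintegral_enorm, Lp.dist_def]
  exact ENNReal.toReal_mono ((Lp.memLp F).sub (Lp.memLp G)).eLpNorm_ne_top
    (eLpNorm_le_eLpNorm_of_exponent_le Fact.out h_meas)

theorem isClosed_setOf_aeConvergentAverage [CompleteSpace E] [IsProbabilityMeasure μ] {p : ℝ≥0∞}
    [Fact (1 ≤ p)] (hτ : MeasurePreserving τ μ μ)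
    (hK : ∀ n ω x, ‖cocycle T τ n ω x‖ ≤ K * ‖x‖) :
    IsClosed {F : Lp E p μ | AEConvergentAverage μ T τ F} := by
  wlog hK0 : 0 < K generalizing K
  · exact this (K := 1) (fun n ω x => (hK n ω x).trans (by gcongr; linarith)) one_pos
  refine isClosed_of_closure_subset fun F hF => ?_
  obtain ⟨G, hG, hGF⟩ := mem_closure_iff_seq_limit.1 hF
  have h_close {c : ℝ} (hc : 0 < c) :
      ∀ᵐ ω ∂μ, ∃ y, ∀ᶠ M in atTop, ‖transferAverage T τ M F ω - y‖ ≤ c := by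
    have h_bound :
        Tendsto (fun k => ENNReal.ofReal (dist F (G k) / (c / (2 * K)))) atTop (𝓝 0) := by
      simpa only [dist_self, zero_div, ENNReal.ofReal_zero] using
        ENNReal.tendsto_ofReal (((tendsto_const_nhds (x := F)).dist hGF).div_const (c / (2 * K)))
    refine ae_iff.2 (nonpos_iff_eq_zero.1 (ge_of_tendsto' h_bound fun k => ?_))
    have h_int : Integrable (F - G k : Ω → E) μ :=
      ((Lp.memLp F).sub (Lp.memLp (G k))).integrable Fact.out
    refine (measure_not_exists_eventually_norm_sub_le hτ hK hK0 h_int (hG k) hc).trans ?_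
    gcongr
    exact integral_norm_sub_le_dist F (G k)
  have h_all : ∀ᵐ ω ∂μ, ∀ k : ℕ, ∃ y, ∀ᶠ M in atTop,
      ‖transferAverage T τ M F ω - y‖ ≤ 1 / ((k : ℝ) + 1) :=
    ae_all_iff.2 fun k => h_close (by positivity)
  filter_upwards [h_all] with ω hω
  refine exists_tendsto_of_forall_eventually_norm_sub_le fun c hc => ?_
  obtain ⟨k, hk⟩ := exists_nat_one_div_lt hc
  exact (hω k).imp fun y hy => hy.mono fun M hM => hM.trans hk.le

end PointwiseErgodic

section LpTransfer

variable {𝕜 Ω E : Type*} [RCLike 𝕜] [NormedAddCommGroup E] [NormedSpace 𝕜 E] [MeasurableSpace Ω]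
  {μ : Measure Ω} {T : Ω → Module.End 𝕜 E} {τ : Ω → Ω} {K : ℝ} {p : ℝ≥0∞} [Fact (1 ≤ p)]

theorem exists_transferLp (hτ : MeasurePreserving τ μ μ)
    (hT : ∀ F : Ω → E, AEStronglyMeasurable F μ → AEStronglyMeasurable (transfer T τ F) μ)
    (hK : ∀ ω x, ‖T ω x‖ ≤ K * ‖x‖) :
    ∃ L : Lp E p μ →L[𝕜] Lp E p μ, ∀ F, L F =ᵐ[μ] transfer T τ F := by
  have h_mem (F : Lp E p μ) : MemLp (transfer T τ F) p μ :=
    MemLp.of_le_mul (c := K) ((Lp.memLp F).comp_measurePreserving hτ)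
      (hT F (Lp.aestronglyMeasurable F)) (ae_of_all _ fun ω => hK ω _)
  let L₀ : Lp E p μ →ₗ[𝕜] Lp E p μ :=
    { toFun F := (h_mem F).toLp
      map_add' F G := by
        rw [← MemLp.toLp_add (h_mem F) (h_mem G), MemLp.toLp_eq_toLp_iff, ← map_add]
        exact transfer_congr_ae T hτ (Lp.coeFn_add F G)
      map_smul' c F := by
        rw [RingHom.id_apply, ← MemLp.toLp_const_smul c (h_mem F), MemLp.toLp_eq_toLp_iff,
          ← map_smul]
        exact transfer_congr_ae T hτ (Lp.coeFn_smul c F) }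
  refine ⟨L₀.mkContinuous K fun F => ?_, fun F => (h_mem F).coeFn_toLp⟩
  rw [← Lp.norm_compMeasurePreserving F hτ]
  refine Lp.norm_le_mul_norm_of_ae_le_mul ?_
  filter_upwards [(h_mem F).coeFn_toLp, Lp.coeFn_compMeasurePreserving F hτ] with ω h_left h_right
  rw [h_right]
  exact (congrArg norm h_left).trans_le (hK ω _)

variable {L : Lp E p μ →L[𝕜] Lp E p μ}

theorem transferLp_pow (hτ : MeasurePreserving τ μ μ) (hL : ∀ F, L F =ᵐ[μ] transfer T τ F) (n : ℕ)
    (F : Lp E p μ) : (L ^ n) F =ᵐ[μ] (transfer T τ)^[n] F := by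
  induction n generalizing F with
  | zero => rfl
  | succ n ih =>
    rw [pow_succ, mul_apply_eq_comp, Function.iterate_succ_apply]
    exact (ih (L F)).trans
      ((ae_forall_transfer_iterate_congr T hτ (hL F)).mono fun ω hω => hω n)

theorem norm_transferLp_pow_le (hτ : MeasurePreserving τ μ μ)
    (hL : ∀ F, L F =ᵐ[μ] transfer T τ F) (hK : ∀ n ω x, ‖cocycle T τ n ω x‖ ≤ K * ‖x‖)
    (hK0 : 0 ≤ K) (n : ℕ) : ‖L ^ n‖ ≤ K := by
  refine ContinuousLinearMap.opNorm_le_bound _ hK0 fun F => ?_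
  rw [← Lp.norm_compMeasurePreserving F (hτ.iterate n)]
  refine Lp.norm_le_mul_norm_of_ae_le_mul ?_
  filter_upwards [transferLp_pow hτ hL n F, Lp.coeFn_compMeasurePreserving F (hτ.iterate n)]
    with ω h_left h_right
  rw [h_left, h_right]
  exact norm_transfer_iterate_le hK n F ω

theorem aeConvergentAverage_of_transfer_ae_eq_self (hτ : MeasurePreserving τ μ μ) {F : Ω → E}
    (hF : transfer T τ F =ᵐ[μ] F) : AEConvergentAverage μ T τ F := by
  have h_iter (n : ℕ) : (transfer T τ)^[n] F =ᵐ[μ] F := by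
    induction n with
    | zero => rfl
    | succ n ih =>
      exact EventuallyEq.trans
        ((ae_forall_transfer_iterate_congr T hτ hF).mono fun ω hω => hω n) ih
  filter_upwards [ae_all_iff.2 h_iter] with ω hω
  refine ⟨F ω, tendsto_const_nhds.congr' ((eventually_ne_atTop 0).mono fun M hM => ?_)⟩
  simp only [transferAverage_apply, birkhoffAverage, birkhoffSum, LinearMap.proj_apply, hω,
    Finset.sum_const, Finset.card_range]
  rw [← Nat.cast_smul_eq_nsmul 𝕜, inv_smul_smul₀ (Nat.cast_ne_zero.2 hM)]

theorem aeConvergentAverage_sub_transferLp [CompleteSpace E] [IsProbabilityMeasure μ]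
    (hp : p ≠ ∞) (hτ : MeasurePreserving τ μ μ)
    (hK : ∀ n ω x, ‖cocycle T τ n ω x‖ ≤ K * ‖x‖) (hL : ∀ F, L F =ᵐ[μ] transfer T τ F)
    (Z : Lp E p μ) : AEConvergentAverage μ T τ (Z - L Z : Lp E p μ) := by
  induction Z using (Lp.simpleFunc.denseRange (E := E) (μ := μ) hp).induction_on with
  | hp => exact (isClosed_setOf_aeConvergentAverage hτ hK).preimage (continuous_id.sub L.continuous)
  | ih s =>
    set z := Lp.simpleFunc.toSimpleFunc s
    obtain ⟨C, hC⟩ := z.exists_forall_norm_le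
    have hzs : z =ᵐ[μ] (s : Lp E p μ) := Lp.simpleFunc.toSimpleFunc_eq_toFun s
    have h_conv : AEConvergentAverage μ T τ (z - transfer T τ z) :=
      ae_of_all _ fun ω => ⟨0, tendsto_transferAverage_sub_transfer hK hC ω⟩
    refine h_conv.congr_ae hτ ?_
    exact (hzs.sub ((transfer_congr_ae T hτ hzs).trans (hL s).symm)).trans
      (Lp.coeFn_sub (s : Lp E p μ) (L s)).symm

theorem aeConvergentAverage_of_mem_ker_sup_range [CompleteSpace E] [IsProbabilityMeasure μ]
    (hp : p ≠ ∞) (hτ : MeasurePreserving τ μ μ)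
    (hK : ∀ n ω x, ‖cocycle T τ n ω x‖ ≤ K * ‖x‖) (hL : ∀ F, L F =ᵐ[μ] transfer T τ F)
    {F : Lp E p μ} (hF : F ∈ (1 - L).ker ⊔ (1 - L).range) : AEConvergentAverage μ T τ F := by
  obtain ⟨Y, hY, W, ⟨Z, hZ⟩, hF⟩ := Submodule.mem_sup.1 hF
  have hYL : Y = L Y := sub_eq_zero.1 hY
  have hY_conv : AEConvergentAverage μ T τ Y := aeConvergentAverage_of_transfer_ae_eq_self hτ
    ((hL Y).symm.trans (ae_of_all _ fun ω => by rw [← hYL]))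
  have hW_conv : AEConvergentAverage μ T τ W :=
    hZ ▸ aeConvergentAverage_sub_transferLp hp hτ hK hL Z
  exact hF ▸ (hY_conv.add hW_conv).congr_ae hτ (Lp.coeFn_add Y W).symm

end LpTransfer

section MeanSquare

variable {𝕜 Ω E : Type*} [RCLike 𝕜] [NormedAddCommGroup E] [MeasurableSpace Ω] {μ : Measure Ω}
  {τ : Ω → Ω} {K : ℝ}

theorem aeConvergentAverage_of_innerProductSpace [IsProbabilityMeasure μ] [InnerProductSpace 𝕜 E]
    [CompleteSpace E] {T : Ω → Module.End 𝕜 E} (hτ : MeasurePreserving τ μ μ)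
    (hT : ∀ F : Ω → E, AEStronglyMeasurable F μ → AEStronglyMeasurable (transfer T τ F) μ)
    (hK : ∀ n ω x, ‖cocycle T τ n ω x‖ ≤ K * ‖x‖) {F : Ω → E} (hF : MemLp F 2 μ) :
    AEConvergentAverage μ T τ F := by
  wlog hK0 : 0 ≤ K generalizing K
  · exact this (K := 0) (fun n ω x => (hK n ω x).trans (by gcongr; linarith)) le_rfl
  obtain ⟨L, hL⟩ := exists_transferLp (p := 2) hτ hT
    fun ω x => by simpa only [cocycle, mul_one] using hK 1 ω x
  have hL_pow : ∀ n, ‖L ^ n‖ ≤ K := norm_transferLp_pow_le hτ hL hK hK0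
  have h_mem : hF.toLp F ∈ {G : Lp E 2 μ | AEConvergentAverage μ T τ G} :=
    closure_minimal
      (fun _ => aeConvergentAverage_of_mem_ker_sup_range ENNReal.ofNat_ne_top hτ hK hL)
      (isClosed_setOf_aeConvergentAverage hτ hK)
      (dense_ker_sup_range_one_sub hL_pow _)
  exact AEConvergentAverage.congr_ae hτ h_mem hF.coeFn_toLp

variable [NormedSpace 𝕜 E] [FiniteDimensional 𝕜 E] {T : Ω → Module.End 𝕜 E}

theorem aestronglyMeasurable_transfer (hτ : MeasurePreserving τ μ μ)
    (hT : ∀ x, AEStronglyMeasurable (fun ω => T ω x) μ) {F : Ω → E}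
    (hF : AEStronglyMeasurable F μ) : AEStronglyMeasurable (transfer T τ F) μ := by
  set b := Module.finBasis 𝕜 E
  have h_expand : transfer T τ F = fun ω => ∑ i, b.coord i (F (τ ω)) • T ω (b i) := by
    ext ω
    simp only [transfer_apply, b.coord_apply, ← map_smul, ← map_sum, b.sum_repr]
  rw [h_expand]
  refine Finset.aestronglyMeasurable_fun_sum _ fun i _ => AEStronglyMeasurable.smul ?_ (hT _)
  exact (b.coord i).continuous_of_finiteDimensional.comp_aestronglyMeasurable
    (hF.comp_measurePreserving hτ)

theorem aeConvergentAverage_of_memLp_two [IsProbabilityMeasure μ] (hτ : MeasurePreserving τ μ μ)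
    (hT : ∀ x, AEStronglyMeasurable (fun ω => T ω x) μ)
    (hK : ∀ n ω x, ‖cocycle T τ n ω x‖ ≤ K * ‖x‖) {F : Ω → E} (hF : MemLp F 2 μ) :
    AEConvergentAverage μ T τ F := by
  let e : E ≃L[𝕜] EuclideanSpace 𝕜 (Fin (Module.finrank 𝕜 E)) :=
    ContinuousLinearEquiv.ofFinrankEq finrank_euclideanSpace_fin.symm
  set T' := fun ω => e.toLinearEquiv.conjRingEquiv (T ω)
  have hT' (x) : AEStronglyMeasurable (fun ω => T' ω x) μ :=
    e.continuous.comp_aestronglyMeasurable (hT (e.symm x))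
  have hK' (n ω x) : ‖cocycle T' τ n ω x‖ ≤
      ‖e.toContinuousLinearMap‖ * (|K| * ‖e.symm.toContinuousLinearMap‖) * ‖x‖ := by
    rw [cocycle_conj_apply, mul_assoc, mul_assoc]
    refine e.toContinuousLinearMap.le_opNorm_of_le ((hK n ω _).trans ?_)
    exact mul_le_mul (le_abs_self K) (e.symm.toContinuousLinearMap.le_opNorm x) (norm_nonneg _)
      (abs_nonneg K)
  have h_conv : AEConvergentAverage μ T' τ (fun ω => e (F ω)) :=
    aeConvergentAverage_of_innerProductSpace hτ
      (fun _ => aestronglyMeasurable_transfer hτ hT') hK'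
      (e.toContinuousLinearMap.comp_memLp' hF)
  filter_upwards [h_conv] with ω ⟨y, hy⟩
  refine ⟨e.symm y, ((e.symm.continuous.tendsto y).comp hy).congr fun M => ?_⟩
  simp only [T', Function.comp_apply, transferAverage_conj_apply,
    ContinuousLinearEquiv.coe_toLinearEquiv, ContinuousLinearEquiv.coe_symm_toLinearEquiv,
    ContinuousLinearEquiv.symm_apply_apply]

end MeanSquare

section StarProjection

variable {A : Type*} [CStarAlgebra A] [PartialOrder A] [StarOrderedRing A] {a p q : A}

theorem mul_eq_self_of_nonneg_of_le_smul (hp : IsStarProjection p) (ha : 0 ≤ a) {C : ℝ}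
    (h : a ≤ C • p) : a * p = a := by
  obtain ⟨b, rfl⟩ := CStarAlgebra.nonneg_iff_eq_star_mul_self.1 ha
  have h_corner : star (b * (1 - p)) * (b * (1 - p)) ≤ 0 := by
    have h_conj := star_left_conjugate_le_conjugate h (1 - p)
    rwa [mul_smul_comm, smul_mul_assoc, mul_assoc _ p, hp.mul_one_sub_self, mul_zero, smul_zero,
      ← mul_assoc, mul_assoc, ← star_mul] at h_conj
  have h_mul : b * (1 - p) = 0 :=
    CStarRing.star_mul_self_eq_zero_iff _ |>.1 (h_corner.antisymm (star_mul_self_nonneg _))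
  rw [mul_sub, mul_one, sub_eq_zero] at h_mul
  rw [mul_assoc, ← h_mul]

theorem le_norm_smul_of_mul_eq_self (hp : IsStarProjection p) (ha : 0 ≤ a) (h : a * p = a) :
    a ≤ ‖a‖ • p := by
  have ha' : IsSelfAdjoint a := .of_nonneg ha
  have h' : p * a = a := by
    simpa only [star_mul, ha'.star_eq, hp.isSelfAdjoint.star_eq] using congrArg star h
  simpa only [hp.isSelfAdjoint.star_eq, h', h, hp.isIdempotentElem.eq] using
    CStarAlgebra.star_left_conjugate_le_norm_smul (a := p) ha'

theorem mul_eq_zero_of_add_le_one (hp : IsStarProjection p) (hq : IsStarProjection q)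
    (h : p + q ≤ 1) : p * q = 0 ∧ q * p = 0 := by
  have hpq : p ≤ 1 - q := le_sub_right_of_add_le h
  have h_right := (hp.le_iff_mul_eq_left hq.one_sub).1 hpq
  have h_left := (hp.le_iff_mul_eq_right hq.one_sub).1 hpq
  rw [mul_sub, mul_one, sub_eq_self] at h_right
  rw [sub_mul, one_mul, sub_eq_self] at h_left
  exact ⟨h_right, h_left⟩

open scoped ComplexOrder InnerProductSpace

theorem map_mul_eq_zero_of_map_eq_zero (f : A →ₚ[ℂ] ℂ) (hp : IsStarProjection p) (hfp : f p = 0)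
    (x : A) : f (x * p) = 0 := by
  have h_norm : ‖f.toPreGNS p‖ = 0 := by
    rw [PositiveLinearMap.preGNS_norm_def, PositiveLinearMap.ofPreGNS_toPreGNS,
      hp.isSelfAdjoint.star_eq, hp.isIdempotentElem.eq, hfp, Complex.zero_re, Real.sqrt_zero]
  have h_cauchy_schwarz := norm_inner_le_norm (𝕜 := ℂ) (f.toPreGNS (star x)) (f.toPreGNS p)
  rwa [h_norm, mul_zero, norm_le_zero_iff, PositiveLinearMap.preGNS_inner_def,
    PositiveLinearMap.ofPreGNS_toPreGNS, PositiveLinearMap.ofPreGNS_toPreGNS, star_star]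
    at h_cauchy_schwarz

theorem map_conj_one_sub_of_map_eq_zero (f : A →ₚ[ℂ] ℂ) (hp : IsStarProjection p)
    (hfp : f p = 0) (x : A) : f ((1 - p) * x * (1 - p)) = f x := by
  have h_left : f (p * x) = 0 := by
    rw [← star_star (p * x), map_star, star_mul, hp.isSelfAdjoint.star_eq,
      map_mul_eq_zero_of_map_eq_zero f hp hfp, star_zero]
  rw [mul_sub, mul_one, map_sub, map_mul_eq_zero_of_map_eq_zero f hp hfp, sub_zero, sub_mul,
    one_mul, map_sub, h_left, sub_zero]

end StarProjection

theorem norm_apply_le_four_mul {A B : Type*} [CStarAlgebra A] [PartialOrder A] [StarOrderedRing A]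
    [CStarAlgebra B] [PartialOrder B] [StarOrderedRing B] (f : A →ₚ[ℂ] B) (x : A) :
    ‖f x‖ ≤ 4 * ‖f 1‖ * ‖x‖ := by
  obtain ⟨y, hy, hy_norm, h_sum⟩ := CStarAlgebra.exists_sum_four_nonneg x
  calc ‖f x‖ = ‖∑ i : Fin 4, Complex.I ^ (i : ℕ) • f (y i)‖ := by
        conv_lhs => rw [h_sum]
        simp only [map_sum, map_smul]
    _ ≤ ∑ _i : Fin 4, ‖f 1‖ * ‖x‖ := norm_sum_le_of_le _ fun i _ => by
        rw [norm_smul, norm_pow, Complex.norm_I, one_pow, one_mul]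
        exact (f.norm_apply_le_of_nonneg _ (hy i)).trans (by gcongr; exact hy_norm i)
    _ = 4 * ‖f 1‖ * ‖x‖ := by simp [mul_assoc]

section Trace

variable {n : Type*} [Fintype n] {A B : Matrix n n ℂ}

open scoped ComplexOrder

theorem trace_mul_nonneg (hA : 0 ≤ A) (hB : 0 ≤ B) : 0 ≤ (A * B).trace := by
  classical
  obtain ⟨C, rfl⟩ := CStarAlgebra.nonneg_iff_eq_star_mul_self.1 hA
  rw [mul_assoc, Matrix.trace_mul_comm]
  exact (Matrix.nonneg_iff_posSemidef.1 (star_right_conjugate_nonneg hB C)).trace_nonneg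

theorem mul_eq_zero_of_trace_mul_eq_zero (hA : 0 ≤ A) (hB : 0 ≤ B) (h : (A * B).trace = 0) :
    A * B = 0 := by
  classical
  obtain ⟨C, rfl⟩ := CStarAlgebra.nonneg_iff_eq_star_mul_self.1 hA
  obtain ⟨D, rfl⟩ := CStarAlgebra.nonneg_iff_eq_star_mul_self.1 hB
  have h_trace : (star (C * star D) * (C * star D)).trace = 0 := by
    rw [← h, star_mul, star_star, mul_assoc, Matrix.trace_mul_comm]
    simp only [mul_assoc]
  have h_mul : C * star D = 0 := Matrix.trace_conjTranspose_mul_self_eq_zero_iff.1 h_trace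
  rw [mul_assoc, ← mul_assoc C, h_mul, zero_mul, mul_zero]

theorem norm_le_trace_re [DecidableEq n] (hA : 0 ≤ A) : ‖A‖ ≤ A.trace.re := by
  have hA' := Matrix.nonneg_iff_posSemidef.1 hA
  have h_trace : A.trace.re = ∑ i, hA'.1.eigenvalues i := by
    simpa using congrArg Complex.re hA'.1.trace_eq_sum_eigenvalues
  rw [CStarAlgebra.norm_le_iff_le_algebraMap A (Complex.le_def.1 hA'.trace_nonneg).1 hA,
    le_algebraMap_iff_spectrum_le (ha := IsSelfAdjoint.of_nonneg hA),
    hA'.1.spectrum_real_eq_range_eigenvalues, Set.forall_mem_range, h_trace]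
  exact fun i => Finset.single_le_sum (fun j _ => hA'.eigenvalues_nonneg j) (Finset.mem_univ i)

/-- The positive functional `X ↦ Tr (X B)` on matrices, for a positive matrix `B`. -/
noncomputable def traceMulRight (hB : 0 ≤ B) : Matrix n n ℂ →ₚ[ℂ] ℂ :=
  .mk₀ (Matrix.traceLinearMap n ℂ ℂ ∘ₗ LinearMap.mulRight ℂ B) fun _ hX => trace_mul_nonneg hX hB

end Trace

section PosTracePreserving

variable {n : Type*} [Fintype n]

/-- A linear map on matrices that is positive and preserves the trace. -/
structure IsPosTracePreserving (Ψ : Module.End ℂ (Matrix n n ℂ)) : Prop where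
  nonneg : ∀ A, 0 ≤ A → 0 ≤ Ψ A
  trace_eq : ∀ A, (Ψ A).trace = A.trace

namespace IsPosTracePreserving

variable {Ψ Ψ' : Module.End ℂ (Matrix n n ℂ)}

theorem one : IsPosTracePreserving (1 : Module.End ℂ (Matrix n n ℂ)) :=
  ⟨fun _ h => h, fun _ => rfl⟩

theorem mul (h : IsPosTracePreserving Ψ) (h' : IsPosTracePreserving Ψ') :
    IsPosTracePreserving (Ψ * Ψ') :=
  ⟨fun A hA => h.nonneg _ (h'.nonneg A hA), fun A => (h.trace_eq _).trans (h'.trace_eq A)⟩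

/-- A positive trace-preserving map as a bundled positive map. -/
noncomputable def toPositiveLinearMap (h : IsPosTracePreserving Ψ) :
    Matrix n n ℂ →ₚ[ℂ] Matrix n n ℂ :=
  .mk₀ Ψ h.nonneg

theorem mono (h : IsPosTracePreserving Ψ) {A B : Matrix n n ℂ} (hAB : A ≤ B) : Ψ A ≤ Ψ B :=
  h.toPositiveLinearMap.monotone' hAB

theorem map_mul_eq_self (h : IsPosTracePreserving Ψ) {A B R : Matrix n n ℂ}
    (hR : IsStarProjection R) (hA : 0 ≤ A) (hB : 0 ≤ B) {C : ℝ} (hAB : A ≤ C • B)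
    (hΨB : Ψ B * R = Ψ B) : Ψ A * R = Ψ A := by
  classical
  refine mul_eq_self_of_nonneg_of_le_smul (C := |C| * ‖Ψ B‖) hR (h.nonneg A hA) ?_
  calc Ψ A ≤ Ψ (|C| • B) :=
        h.mono (hAB.trans (smul_le_smul_of_nonneg_right (le_abs_self C) hB))
    _ = |C| • Ψ B := by rw [← Complex.coe_smul, map_smul, Complex.coe_smul]
    _ ≤ |C| • ‖Ψ B‖ • R := smul_le_smul_of_nonneg_left
        (le_norm_smul_of_mul_eq_self hR (h.nonneg B hB) hΨB) (abs_nonneg C)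
    _ = (|C| * ‖Ψ B‖) • R := smul_smul _ _ _

variable [DecidableEq n]

theorem norm_map_one_le (h : IsPosTracePreserving Ψ) : ‖Ψ 1‖ ≤ Fintype.card n := by
  simpa only [h.trace_eq, Matrix.trace_one, Complex.natCast_re] using
    norm_le_trace_re (h.nonneg 1 zero_le_one)

theorem norm_apply_le (h : IsPosTracePreserving Ψ) (A : Matrix n n ℂ) :
    ‖Ψ A‖ ≤ 4 * Fintype.card n * ‖A‖ :=
  (norm_apply_le_four_mul h.toPositiveLinearMap A).trans (by gcongr; exact h.norm_map_one_le)

open scoped ComplexOrder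

variable {R R' S S' : Matrix n n ℂ}

theorem trace_mul_one_sub_le (h : IsPosTracePreserving Ψ) (hR : IsStarProjection R)
    (hR' : IsStarProjection R') (hΨ : Ψ R' * R = Ψ R') {A : Matrix n n ℂ} (hA : 0 ≤ A) :
    (Ψ A * (1 - R)).trace ≤ (A * (1 - R')).trace := by
  let f := (traceMulRight hR.one_sub.nonneg).comp h.toPositiveLinearMap
  have hf (X) : f X = (Ψ X * (1 - R)).trace := rfl
  have hf_R' : f R' = 0 := by rw [hf, mul_sub, mul_one, hΨ, sub_self, Matrix.trace_zero]
  set A' := (1 - R') * A * (1 - R')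
  have hA' : 0 ≤ A' := by
    simpa only [hR'.one_sub.isSelfAdjoint.star_eq] using star_left_conjugate_nonneg hA (1 - R')
  calc (Ψ A * (1 - R)).trace = (Ψ A' * (1 - R)).trace :=
        (map_conj_one_sub_of_map_eq_zero f hR' hf_R' A).symm
    _ ≤ (Ψ A').trace := by
        rw [mul_sub, mul_one, Matrix.trace_sub]
        exact sub_le_self _ (trace_mul_nonneg (h.nonneg A' hA') hR.nonneg)
    _ = (A * (1 - R')).trace := by
        rw [h.trace_eq, Matrix.trace_mul_comm, ← mul_assoc, hR'.one_sub.isIdempotentElem.eq,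
          Matrix.trace_mul_comm]

theorem trace_mul_one_sub_eq (h : IsPosTracePreserving Ψ) (hR : IsStarProjection R)
    (hR' : IsStarProjection R') (hΨ : Ψ R' * R = Ψ R') {E X : Matrix n n ℂ} {C : ℝ}
    (hE : (Ψ E * (1 - R)).trace = (E * (1 - R')).trace) (hX : 0 ≤ X) (hXE : X ≤ C • E) :
    (Ψ X * (1 - R)).trace = (X * (1 - R')).trace := by
  let τ := Matrix.traceLinearMap n ℂ ℂ
  let g : Matrix n n ℂ →ₚ[ℂ] ℂ :=
    .mk₀ (τ ∘ₗ LinearMap.mulRight ℂ (1 - R') - τ ∘ₗ LinearMap.mulRight ℂ (1 - R) ∘ₗ Ψ)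
      fun A hA => sub_nonneg.2 (h.trace_mul_one_sub_le hR hR' hΨ hA)
  have hg (A) : g A = (A * (1 - R')).trace - (Ψ A * (1 - R)).trace := rfl
  have hg_E : g (C • E) = 0 := by
    rw [← Complex.coe_smul, map_smul, hg, hE, sub_self, smul_zero]
  have hg_X : g X = 0 := ((OrderHomClass.mono g hXE).trans_eq hg_E).antisymm (g.map_nonneg hX)
  exact (sub_eq_zero.1 ((hg X).symm.trans hg_X)).symm

theorem map_sub_mul_sub (h : IsPosTracePreserving Ψ) (hR : IsStarProjection R)
    (hR' : IsStarProjection R') (hS : IsStarProjection S) (hS' : IsStarProjection S')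
    (hRS' : R' ≤ S') (hΨR : Ψ R' * R = Ψ R') (hΨS : Ψ S' * S = Ψ S') {E : Matrix n n ℂ} {C : ℝ}
    (hE : (Ψ E * (1 - R)).trace = (E * (1 - R')).trace) (hSE : S' ≤ C • E) :
    Ψ (S' - R') * (S - R) = Ψ (S' - R') := by
  have hX : 0 ≤ S' - R' := sub_nonneg.2 hRS'
  have hX_le : S' - R' ≤ S' := sub_le_self _ hR'.nonneg
  have h_mul_R : Ψ (S' - R') * R = 0 := by
    have hX_mul_R' : (S' - R') * R' = 0 := by
      rw [sub_mul, hR'.isIdempotentElem.eq, (hR'.le_iff_mul_eq_right hS').1 hRS', sub_self]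
    refine mul_eq_zero_of_trace_mul_eq_zero (h.nonneg _ hX) hR.nonneg ?_
    have h_trace := h.trace_mul_one_sub_eq hR hR' hΨR hE hX (hX_le.trans hSE)
    rwa [mul_sub, mul_sub, hX_mul_R', sub_zero, mul_one, mul_one, Matrix.trace_sub, h.trace_eq,
      sub_eq_self] at h_trace
  have h_mul_S : Ψ (S' - R') * S = Ψ (S' - R') :=
    h.map_mul_eq_self hS hX hS'.nonneg (C := 1) (by rwa [one_smul]) hΨS
  rw [mul_sub, h_mul_R, h_mul_S, sub_zero]

end IsPosTracePreserving

end PosTracePreserving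

theorem tendsto_average_pow {A : Type*} [NormedRing A] [NormedAlgebra ℝ A] {b p g : A}
    (hb : ‖b‖ ≤ 1) (hp : b * p = p) (hg : (1 - b) * g = 1 - p) :
    Tendsto (fun n : ℕ => (n : ℝ)⁻¹ • ∑ k ∈ Finset.range n, b ^ k) atTop (𝓝 p) := by
  let L := LinearMap.mulLeft ℝ b
  let avg (x : A) (n : ℕ) := birkhoffAverage ℝ L (AddMonoidHom.id A) n x
  have h_bounded : Bornology.IsBounded (Set.range fun n => AddMonoidHom.id A (L^[n] g)) := by
    refine isBounded_iff_forall_norm_le.2 ⟨‖g‖, Set.forall_mem_range.2 fun n => ?_⟩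
    induction n with
    | zero => rfl
    | succ n ih =>
      rw [Function.iterate_succ_apply']
      exact (norm_mul_le b _).trans ((mul_le_of_le_one_left (norm_nonneg _) hb).trans ih)
  have h_coboundary : Tendsto (avg (1 - p)) atTop (𝓝 0) := by
    rw [← hg, sub_mul, one_mul]
    exact tendsto_birkhoffAverage_sub_map ℝ h_bounded
  have h_fixed : Tendsto (avg p) atTop (𝓝 p) :=
    Function.IsFixedPt.tendsto_birkhoffAverage ℝ (f := L) hp _
  have h_one := h_coboundary.add h_fixed
  rw [zero_add] at h_one
  refine h_one.congr fun n => ?_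
  calc avg (1 - p) n + avg p n = avg 1 n :=
        (sub_eq_iff_eq_add.1 (birkhoffAverage_map_sub ℝ L (AddMonoidHom.id A) n 1 p).symm).symm
    _ = (n : ℝ)⁻¹ • ∑ k ∈ Finset.range n, b ^ k := by
        refine congrArg _ (Finset.sum_congr rfl fun k _ => ?_)
        rw [← Module.End.pow_apply, LinearMap.pow_mulLeft]
        exact mul_one _

section RangeProj

variable {d : ℕ}

theorem toEuclideanCLM_rangeProj (A : Mat d) :
    Matrix.toEuclideanCLM (n := Fin d) (𝕜 := ℂ) (rangeProj A) = (LinearMap.range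
      (Matrix.toEuclideanCLM (n := Fin d) (𝕜 := ℂ) A).toLinearMap).starProjection :=
  StarAlgEquiv.apply_symm_apply _ _

theorem isStarProjection_rangeProj (A : Mat d) : IsStarProjection (rangeProj A) := by
  have h := isStarProjection_starProjection (U := LinearMap.range
    (Matrix.toEuclideanCLM (n := Fin d) (𝕜 := ℂ) A).toLinearMap)
  constructor <;> apply EquivLike.injective (Matrix.toEuclideanCLM (n := Fin d) (𝕜 := ℂ))
  · rw [map_mul, toEuclideanCLM_rangeProj, h.isIdempotentElem.eq]
  · rw [map_star, toEuclideanCLM_rangeProj, h.isSelfAdjoint.star_eq]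

theorem rangeProj_mul_self (A : Mat d) : rangeProj A * A = A := by
  apply EquivLike.injective (Matrix.toEuclideanCLM (n := Fin d) (𝕜 := ℂ))
  ext1 v
  rw [map_mul, toEuclideanCLM_rangeProj]
  exact Submodule.starProjection_eq_self_iff.2 ⟨v, rfl⟩

theorem exists_mul_eq_rangeProj (A : Mat d) : ∃ G, A * G = rangeProj A := by
  let e := Matrix.toEuclideanCLM (n := Fin d) (𝕜 := ℂ)
  let T := (e A).toLinearMap
  obtain ⟨S, hS⟩ := Module.projective_lifting_property T.rangeRestrict
    T.range.orthogonalProjectionOnto.toLinearMap T.surjective_rangeRestrict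
  refine ⟨e.symm (LinearMap.toContinuousLinearMap S), EquivLike.injective e ?_⟩
  rw [map_mul, StarAlgEquiv.apply_symm_apply, toEuclideanCLM_rangeProj]
  ext1 v
  exact congrArg Subtype.val (LinearMap.congr_fun hS v)

variable {A : Mat d}

theorem self_mul_rangeProj (hA : IsSelfAdjoint A) : A * rangeProj A = A := by
  simpa only [star_mul, hA.star_eq, (isStarProjection_rangeProj A).isSelfAdjoint.star_eq] using
    congrArg star (rangeProj_mul_self A)

theorem exists_rangeProj_le_smul (hA : 0 ≤ A) : ∃ C : ℝ, rangeProj A ≤ C • A := by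
  obtain ⟨G, hG⟩ := exists_mul_eq_rangeProj A
  obtain ⟨B, rfl⟩ := CStarAlgebra.nonneg_iff_eq_star_mul_self.1 hA
  have hR := isStarProjection_rangeProj (star B * B)
  have h_eq : rangeProj (star B * B) = star B * ((B * G) * star (B * G)) * B := by
    rw [← hR.isIdempotentElem.eq]
    nth_rw 2 [← hR.isSelfAdjoint.star_eq]
    rw [← hG]
    simp only [star_mul, star_star, mul_assoc]
  exact ⟨_, h_eq.le.trans (CStarAlgebra.star_left_conjugate_le_norm_smul (.mul_star_self _))⟩

theorem tendsto_rangeProj (hA : 0 ≤ A) {K : ℝ} (hK : 0 < K) (hAK : ‖A‖ ≤ K) :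
    Tendsto (fun n : ℕ => 1 - (n : ℝ)⁻¹ • ∑ k ∈ Finset.range n, (1 - K⁻¹ • A) ^ k) atTop
      (𝓝 (rangeProj A)) := by
  obtain ⟨G, hG⟩ := exists_mul_eq_rangeProj A
  have h_norm : ‖1 - K⁻¹ • A‖ ≤ 1 := by
    have h_le_one : K⁻¹ • A ≤ 1 := by
      refine (CStarAlgebra.norm_le_one_iff_of_nonneg _ (by positivity)).1 ?_
      rw [norm_smul, norm_inv, Real.norm_of_nonneg hK.le]
      exact inv_mul_le_one_of_le₀ hAK hK.le
    exact (CStarAlgebra.norm_le_one_iff_of_nonneg _ (sub_nonneg.2 h_le_one)).2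
      (sub_le_self _ (by positivity))
  have h_lim := tendsto_average_pow (p := 1 - rangeProj A) (g := K • G) h_norm
    (by rw [sub_mul, one_mul, smul_mul_assoc, mul_sub, mul_one, self_mul_rangeProj (.of_nonneg hA),
      sub_self, smul_zero, sub_zero])
    (by rw [sub_sub_cancel, sub_sub_cancel, smul_mul_smul_comm, inv_mul_cancel₀ hK.ne', one_smul,
      hG])
  simpa only [sub_sub_cancel] using h_lim.const_sub 1

end RangeProj

section RandomProjection

variable {Ω : Type*} [MeasurableSpace Ω] {μ : Measure Ω} {d : ℕ}

/-- The real part of the trace as a continuous functional, used to move limits and integrals through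
the trace. -/
noncomputable def traceReCLM (d : ℕ) : Mat d →L[ℝ] ℝ :=
  Complex.reCLM ∘L
    (Matrix.traceLinearMap (Fin d) ℂ ℂ).toContinuousLinearMap.restrictScalars ℝ

theorem IsRandomProjection.one_sub {P : Ω → Mat d} (hP : IsRandomProjection μ P) :
    IsRandomProjection μ fun ω => 1 - P ω :=
  ⟨aestronglyMeasurable_const.sub hP.1, hP.2.mono fun _ hω => hω.one_sub⟩

theorem IsRandomProjection.ae_norm_mul_le {P : Ω → Mat d} (hP : IsRandomProjection μ P)
    (F : Ω → Mat d) : ∀ᵐ ω ∂μ, ‖F ω * P ω‖ ≤ ‖F ω‖ :=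
  hP.2.mono fun _ hω =>
    (norm_mul_le _ _).trans (mul_le_of_le_one_right (norm_nonneg _) hω.norm_le)

theorem IsRandomProjection.integrable_trace_mul_re {P : Ω → Mat d} (hP : IsRandomProjection μ P)
    {F : Ω → Mat d} (hF : Integrable F μ) : Integrable (fun ω => (F ω * P ω).trace.re) μ :=
  (traceReCLM d).integrable_comp
    (hF.mono (hF.aestronglyMeasurable.mul hP.1) (hP.ae_norm_mul_le F))

end RandomProjection

theorem IsPosTracePreserving.cocycle {Ω n : Type*} [Fintype n]
    {T : Ω → Module.End ℂ (Matrix n n ℂ)} (hT : ∀ ω, IsPosTracePreserving (T ω)) (τ : Ω → Ω)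
    (N : ℕ) (ω : Ω) : IsPosTracePreserving (cocycle T τ N ω) := by
  induction N generalizing ω with
  | zero => exact .one
  | succ N ih => exact (hT ω).mul (ih (τ ω))

namespace ERIS

variable {Ω : Type*} [MeasurableSpace Ω] {μ : Measure Ω} {d : ℕ} (Q : ERIS Ω μ d)

theorem measurePreserving : MeasurePreserving Q.θ μ μ := Q.ergodic.toMeasurePreserving

theorem measurePreserving_symm : MeasurePreserving Q.θ.symm μ μ :=
  Q.ergodic.symm.toMeasurePreserving

section Evolution

/-- The channel of `Q` as a random element of the ring of endomorphisms. -/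
def channelEnd (ω : Ω) : Module.End ℂ (Mat d) := (Q.φ ω).toLinearMap

theorem isPosTracePreserving_channelEnd (ω : Ω) : IsPosTracePreserving (Q.channelEnd ω) :=
  ⟨fun _ hA => map_nonneg (Q.φ ω).toCompletelyPositiveMap hA, (Q.φ ω).trace_preserving⟩

/-- The one-step evolution `(evolve F) ω = φ_ω (F (θ⁻¹ ω))` of random matrices. -/
def evolve : Module.End ℂ (Ω → Mat d) := transfer Q.channelEnd Q.θ.symm

theorem evolve_apply (F : Ω → Mat d) (ω : Ω) :
    Q.evolve F ω = Q.channelEnd ω (F (Q.θ.symm ω)) := rfl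

theorem evolve_iterate_apply (n : ℕ) (F : Ω → Mat d) (ω : Ω) :
    Q.evolve^[n] F ω = cocycle Q.channelEnd Q.θ.symm n ω (F (Q.θ.symm^[n] ω)) :=
  transfer_iterate_apply _ _ n F ω

theorem isPosTracePreserving_cocycle (n : ℕ) (ω : Ω) :
    IsPosTracePreserving (cocycle Q.channelEnd Q.θ.symm n ω) :=
  .cocycle Q.isPosTracePreserving_channelEnd Q.θ.symm n ω

theorem evolve_iterate_nonneg (n : ℕ) {F : Ω → Mat d} {ω : Ω} (h : 0 ≤ F (Q.θ.symm^[n] ω)) :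
    0 ≤ Q.evolve^[n] F ω :=
  Q.evolve_iterate_apply n F ω ▸ (Q.isPosTracePreserving_cocycle n ω).nonneg _ h

theorem evolve_iterate_mono (n : ℕ) {F G : Ω → Mat d} {ω : Ω}
    (h : F (Q.θ.symm^[n] ω) ≤ G (Q.θ.symm^[n] ω)) : Q.evolve^[n] F ω ≤ Q.evolve^[n] G ω := by
  rw [evolve_iterate_apply, evolve_iterate_apply]
  exact (Q.isPosTracePreserving_cocycle n ω).mono h

theorem evolve_iterate_one_nonneg (n : ℕ) (ω : Ω) : 0 ≤ Q.evolve^[n] 1 ω :=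
  Q.evolve_iterate_nonneg n zero_le_one

theorem norm_evolve_iterate_one_le (n : ℕ) (ω : Ω) : ‖Q.evolve^[n] 1 ω‖ ≤ d := by
  simpa only [evolve_iterate_apply, Pi.one_apply, Fintype.card_fin] using
    (Q.isPosTracePreserving_cocycle n ω).norm_map_one_le

theorem norm_cocycle_apply_le (n : ℕ) (ω : Ω) (A : Mat d) :
    ‖cocycle Q.channelEnd Q.θ.symm n ω A‖ ≤ 4 * d * ‖A‖ := by
  simpa only [Fintype.card_fin] using (Q.isPosTracePreserving_cocycle n ω).norm_apply_le A

theorem aestronglyMeasurable_evolve_iterate (n : ℕ) {F : Ω → Mat d}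
    (hF : AEStronglyMeasurable F μ) : AEStronglyMeasurable (Q.evolve^[n] F) μ := by
  induction n generalizing F with
  | zero => exact hF
  | succ _ ih => exact ih (aestronglyMeasurable_transfer Q.measurePreserving_symm Q.measurable_φ hF)

end Evolution

section Propagator

theorem shift_natCast (n : ℕ) : Q.shift n = Q.θ^[n] := by
  rw [shift, zpow_natCast, Equiv.Perm.coe_pow]
  rfl

theorem shift_neg_natCast (n : ℕ) : Q.shift (-n) = Q.θ.symm^[n] := by
  rw [shift, zpow_neg, ← inv_zpow, zpow_natCast, Equiv.Perm.coe_pow]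
  rfl

theorem forward_apply (N : ℕ) (F : Ω → Mat d) (ω : Ω) :
    Q.forward N ω (F ω) = Q.evolve^[N] F (Q.θ^[N] ω) := by
  induction N with
  | zero => rfl
  | succ N ih =>
    rw [forward, LinearMap.comp_apply, ih, Function.iterate_succ_apply' Q.evolve, evolve_apply,
      channel, ← Nat.cast_succ, shift_natCast, Function.iterate_succ_apply' Q.θ,
      MeasurableEquiv.symm_apply_apply, channelEnd]

theorem backward_eq_cocycle (N : ℕ) (ω : Ω) :
    Q.backward N ω = cocycle Q.channelEnd Q.θ.symm (N + 1) ω := by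
  induction N with
  | zero => rfl
  | succ N ih =>
    rw [backward, ih, cocycle_succ' _ _ (N + 1), channel, ← Nat.cast_succ, shift_neg_natCast]
    rfl

theorem Phi_natCast_apply {N : ℕ} (hN : 1 ≤ N) (F : Ω → Mat d) (ω : Ω) :
    Q.Phi N ω (F ω) = Q.evolve^[N] F (Q.θ^[N] ω) := by
  rw [Phi, if_pos (by exact_mod_cast hN), Int.toNat_natCast, forward_apply]

theorem Phi_neg_natCast_one (N : ℕ) (ω : Ω) : Q.Phi (-N) ω 1 = Q.evolve^[N + 1] 1 ω := by
  rw [Phi, if_neg (by simp), neg_neg, Int.toNat_natCast, backward_eq_cocycle, evolve_iterate_apply]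
  rfl

end Propagator

section Cesaro

theorem cesaroAvgOne_eq_sum (M : ℕ) (ω : Ω) :
    Q.cesaroAvgOne M ω = (M : ℝ)⁻¹ • ∑ N ∈ Finset.range M, Q.evolve^[N + 1] 1 ω := by
  simp only [cesaroAvgOne, Phi_neg_natCast_one]

theorem cesaroAvgOne_eq_transferAverage (M : ℕ) (ω : Ω) :
    Q.cesaroAvgOne M ω = transferAverage Q.channelEnd Q.θ.symm M (Q.evolve 1) ω := by
  rw [cesaroAvgOne_eq_sum, transferAverage_apply, birkhoffAverage_congr_ring ℂ ℝ]
  rfl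

theorem cesaroAvgOne_nonneg (M : ℕ) (ω : Ω) : 0 ≤ Q.cesaroAvgOne M ω := by
  rw [cesaroAvgOne_eq_sum]
  exact smul_nonneg (by positivity) (Finset.sum_nonneg fun N _ => Q.evolve_iterate_one_nonneg _ ω)

theorem norm_cesaroAvgOne_le (M : ℕ) (ω : Ω) : ‖Q.cesaroAvgOne M ω‖ ≤ d := by
  have h_sum : ‖∑ N ∈ Finset.range M, Q.evolve^[N + 1] 1 ω‖ ≤ M * d := by
    have h := norm_sum_le_of_le (Finset.range M) fun N _ => Q.norm_evolve_iterate_one_le (N + 1) ω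
    rwa [Finset.sum_const, Finset.card_range, nsmul_eq_mul] at h
  rw [cesaroAvgOne_eq_sum, norm_smul, norm_inv, Real.norm_natCast]
  exact inv_mul_le_of_le_mul₀ (by positivity) (by positivity) h_sum

theorem aestronglyMeasurable_cesaroAvgOne (M : ℕ) :
    AEStronglyMeasurable (Q.cesaroAvgOne M) μ := by
  simp only [funext (Q.cesaroAvgOne_eq_sum M)]
  exact AEStronglyMeasurable.const_smul (Finset.aestronglyMeasurable_fun_sum _ fun N _ =>
    Q.aestronglyMeasurable_evolve_iterate (N + 1) aestronglyMeasurable_one) (M : ℝ)⁻¹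

variable [IsProbabilityMeasure μ]

theorem ae_tendsto_cesaroAvgOne :
    ∀ᵐ ω ∂μ, Tendsto (fun M : ℕ => Q.cesaroAvgOne M ω) atTop (𝓝 (Q.cesaroLimitOne ω)) := by
  have h_memLp : MemLp (Q.evolve 1) 2 μ :=
    .of_bound (Q.aestronglyMeasurable_evolve_iterate 1 aestronglyMeasurable_one) d
      (ae_of_all _ fun ω => Q.norm_evolve_iterate_one_le 1 ω)
  filter_upwards [aeConvergentAverage_of_memLp_two (T := Q.channelEnd)
    Q.measurePreserving_symm Q.measurable_φ Q.norm_cocycle_apply_le h_memLp] with ω hω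
  exact tendsto_nhds_limUnder (by simpa only [cesaroAvgOne_eq_transferAverage] using hω)

theorem aestronglyMeasurable_cesaroLimitOne : AEStronglyMeasurable Q.cesaroLimitOne μ :=
  aestronglyMeasurable_of_tendsto_ae atTop Q.aestronglyMeasurable_cesaroAvgOne
    Q.ae_tendsto_cesaroAvgOne

theorem ae_cesaroLimitOne_nonneg : ∀ᵐ ω ∂μ, 0 ≤ Q.cesaroLimitOne ω :=
  Q.ae_tendsto_cesaroAvgOne.mono fun ω hω => ge_of_tendsto' hω fun M => Q.cesaroAvgOne_nonneg M ω

theorem ae_norm_cesaroLimitOne_le : ∀ᵐ ω ∂μ, ‖Q.cesaroLimitOne ω‖ ≤ d :=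
  Q.ae_tendsto_cesaroAvgOne.mono fun ω hω =>
    le_of_tendsto' hω.norm fun M => Q.norm_cesaroAvgOne_le M ω

theorem integrable_cesaroLimitOne : Integrable Q.cesaroLimitOne μ :=
  .of_bound Q.aestronglyMeasurable_cesaroLimitOne d Q.ae_norm_cesaroLimitOne_le

theorem evolve_cesaroLimitOne : Q.evolve Q.cesaroLimitOne =ᵐ[μ] Q.cesaroLimitOne :=
  transfer_ae_eq_self_of_tendsto Q.measurePreserving_symm Q.norm_cocycle_apply_le
    (F := Q.evolve 1) (Q.norm_evolve_iterate_one_le 1)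
    (by simpa only [cesaroAvgOne_eq_transferAverage] using Q.ae_tendsto_cesaroAvgOne)

end Cesaro

section RecurrentProj

theorem isStarProjection_recurrentProj (ω : Ω) : IsStarProjection (Q.recurrentProj ω) :=
  isStarProjection_rangeProj _

theorem isStarProjection_transientProj (ω : Ω) : IsStarProjection (Q.transientProj ω) :=
  (Q.isStarProjection_recurrentProj ω).one_sub

variable [IsProbabilityMeasure μ]

theorem aestronglyMeasurable_recurrentProj : AEStronglyMeasurable Q.recurrentProj μ := by
  have h_pos : (0 : ℝ) < d + 1 := by positivity
  have h_tendsto : ∀ᵐ ω ∂μ, Tendsto (fun n : ℕ => 1 - (n : ℝ)⁻¹ • ∑ k ∈ Finset.range n,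
      (1 - ((d : ℝ) + 1)⁻¹ • Q.cesaroLimitOne ω) ^ k) atTop (𝓝 (Q.recurrentProj ω)) := by
    filter_upwards [Q.ae_cesaroLimitOne_nonneg, Q.ae_norm_cesaroLimitOne_le] with ω h_nonneg h_norm
    exact tendsto_rangeProj h_nonneg h_pos (h_norm.trans (le_add_of_nonneg_right zero_le_one))
  refine aestronglyMeasurable_of_tendsto_ae atTop (fun n => ?_) h_tendsto
  have h_continuous : Continuous fun A : Mat d =>
      1 - (n : ℝ)⁻¹ • ∑ k ∈ Finset.range n, (1 - ((d : ℝ) + 1)⁻¹ • A) ^ k := by fun_prop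
  exact h_continuous.comp_aestronglyMeasurable Q.aestronglyMeasurable_cesaroLimitOne

theorem isRandomProjection_recurrentProj : IsRandomProjection μ Q.recurrentProj :=
  ⟨Q.aestronglyMeasurable_recurrentProj, ae_of_all _ Q.isStarProjection_recurrentProj⟩

theorem isRandomProjection_transientProj : IsRandomProjection μ Q.transientProj :=
  Q.isRandomProjection_recurrentProj.one_sub

theorem ae_cesaroLimitOne_mul_transientProj :
    ∀ᵐ ω ∂μ, Q.cesaroLimitOne ω * Q.transientProj ω = 0 := by
  filter_upwards [Q.ae_cesaroLimitOne_nonneg] with ω hω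
  rw [transientProj, mul_sub, mul_one, recurrentProj, self_mul_rangeProj (.of_nonneg hω), sub_self]

end RecurrentProj

end ERIS

section Reducing

variable {Ω : Type*} [MeasurableSpace Ω] {μ : Measure Ω} {d : ℕ} {Q : ERIS Ω μ d}
  {P R S : Ω → Mat d}

/-- The channel maps the corner of `P` at `θ⁻¹ ω` into the corner of `P` at `ω`. This one-step
condition characterizes the reducing projections. -/
def IsInvariant (Q : ERIS Ω μ d) (P : Ω → Mat d) : Prop :=
  ∀ᵐ ω ∂μ, Q.evolve P ω * P ω = Q.evolve P ω

theorem IsInvariant.evolve_iterate_mul (h : IsInvariant Q P)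
    (hP : ∀ᵐ ω ∂μ, IsStarProjection (P ω)) (N : ℕ) :
    ∀ᵐ ω ∂μ, Q.evolve^[N] P ω * P ω = Q.evolve^[N] P ω := by
  induction N with
  | zero => exact hP.mono fun ω hω => hω.isIdempotentElem.eq
  | succ N ih =>
    have hθ := Q.measurePreserving_symm.quasiMeasurePreserving
    have hθN := (Q.measurePreserving_symm.iterate (N + 1)).quasiMeasurePreserving
    filter_upwards [hP, h, hθ.ae hP, hθ.ae ih, hθN.ae hP] with ω hPω hω hPθ hθω hPθN
    rw [Function.iterate_succ_apply', Q.evolve_apply]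
    have h_nonneg : 0 ≤ Q.evolve^[N] P (Q.θ.symm ω) := Q.evolve_iterate_nonneg N hPθN.nonneg
    exact (Q.isPosTracePreserving_channelEnd ω).map_mul_eq_self hPω h_nonneg hPθ.nonneg
      (le_norm_smul_of_mul_eq_self hPθ h_nonneg hθω) hω

theorem IsInvariant.evolve_iterate_le (h : IsInvariant Q P)
    (hP : ∀ᵐ ω ∂μ, IsStarProjection (P ω)) (N : ℕ) :
    ∀ᵐ ω ∂μ, Q.evolve^[N] P ω ≤ ((d : ℝ) + 1) • P ω := by
  filter_upwards [hP, h.evolve_iterate_mul hP N,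
    (Q.measurePreserving_symm.iterate N).quasiMeasurePreserving.ae hP] with ω hPω hω hPθ
  have h_nonneg : 0 ≤ Q.evolve^[N] P ω := Q.evolve_iterate_nonneg N hPθ.nonneg
  have h_norm : ‖Q.evolve^[N] P ω‖ ≤ d :=
    (CStarAlgebra.norm_le_norm_of_nonneg_of_le h_nonneg
      (Q.evolve_iterate_mono N hPθ.le_one)).trans (Q.norm_evolve_iterate_one_le N ω)
  exact (le_norm_smul_of_mul_eq_self hPω h_nonneg hω).trans
    (smul_le_smul_of_nonneg_right (h_norm.trans (le_add_of_nonneg_right zero_le_one)) hPω.nonneg)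

theorem reduces_iff : Reduces Q P ↔ IsRandomProjection μ P ∧ IsInvariant Q P := by
  refine ⟨fun ⟨hP, C, _, _, hC⟩ => ⟨hP, ?_⟩, fun ⟨hP, h⟩ =>
    ⟨hP, fun _ => (d : ℝ) + 1, aemeasurable_const, ae_of_all _ fun _ => by positivity,
      fun N hN => ?_⟩⟩
  · have hθ := Q.measurePreserving_symm.quasiMeasurePreserving
    filter_upwards [hP.2, hθ.ae hP.2, hθ.ae (hC 1 le_rfl)] with ω hPω hPθ hCω
    rw [Q.Phi_natCast_apply le_rfl, Q.shift_natCast, Function.iterate_one, Function.iterate_one,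
      MeasurableEquiv.apply_symm_apply] at hCω
    exact mul_eq_self_of_nonneg_of_le_smul hPω (Q.evolve_iterate_nonneg 1 hPθ.nonneg) hCω
  · filter_upwards [(Q.measurePreserving.iterate N).quasiMeasurePreserving.ae
      (h.evolve_iterate_le hP.2 N)] with ω hω
    rwa [Q.Phi_natCast_apply hN, Q.shift_natCast]

theorem Reduces.ae_ne_zero [IsFiniteMeasure μ] (h : Reduces Q P) (hP : ¬ ∀ᵐ ω ∂μ, P ω = 0) :
    ∀ᵐ ω ∂μ, P ω ≠ 0 := by
  have h_null : NullMeasurableSet {ω | P ω = 0} μ :=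
    h.1.1.nullMeasurableSet_eq_fun aestronglyMeasurable_const
  have h_le : {ω | P ω = 0} ≤ᵐ[μ] Q.θ.symm ⁻¹' {ω | P ω = 0} := by
    filter_upwards [(reduces_iff.1 h).2,
      Q.measurePreserving_symm.quasiMeasurePreserving.ae h.1.2] with ω h_inv hPθ (hPω : P ω = 0)
    have h_trace : (P (Q.θ.symm ω)).trace = 0 := by
      rw [← (Q.isPosTracePreserving_channelEnd ω).trace_eq, ← Q.evolve_apply, ← h_inv, hPω,
        mul_zero, Matrix.trace_zero]
    exact norm_le_zero_iff.1 ((norm_le_trace_re hPθ.nonneg).trans_eq (congrArg Complex.re h_trace))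
  rcases Q.ergodic.symm.ae_empty_or_univ_of_ae_le_preimage h_null h_le with h_empty | h_univ
  · exact eventuallyEq_empty.1 h_empty
  · exact absurd (eventuallyEq_univ.1 h_univ) hP

variable [IsProbabilityMeasure μ]

theorem reduces_recurrentProj (Q : ERIS Ω μ d) : Reduces Q Q.recurrentProj := by
  refine reduces_iff.2 ⟨Q.isRandomProjection_recurrentProj, ?_⟩
  have hθ := Q.measurePreserving_symm.quasiMeasurePreserving
  filter_upwards [Q.evolve_cesaroLimitOne, Q.ae_cesaroLimitOne_nonneg,
    hθ.ae Q.ae_cesaroLimitOne_nonneg] with ω h_evolve hE hEθ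
  obtain ⟨C, hC⟩ := exists_rangeProj_le_smul hEθ
  refine (Q.isPosTracePreserving_channelEnd ω).map_mul_eq_self
    (Q.isStarProjection_recurrentProj ω) (Q.isStarProjection_recurrentProj _).nonneg hEθ hC ?_
  rw [← Q.evolve_apply, h_evolve]
  exact self_mul_rangeProj (.of_nonneg hE)

open scoped ComplexOrder in
/-- The trace is a subinvariant function of `ω` with the same integral as its translate, so it is
invariant. -/
theorem IsInvariant.ae_trace_cesaroLimitOne_mul_one_sub_eq (h : IsInvariant Q R)
    (hR : IsRandomProjection μ R) : ∀ᵐ ω ∂μ, (Q.cesaroLimitOne ω * (1 - R ω)).trace =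
      (Q.cesaroLimitOne (Q.θ.symm ω) * (1 - R (Q.θ.symm ω))).trace := by
  have hθ := Q.measurePreserving_symm.quasiMeasurePreserving
  let f (ω : Ω) : ℂ := (Q.cesaroLimitOne ω * (1 - R ω)).trace
  have hf_le : ∀ᵐ ω ∂μ, f ω ≤ f (Q.θ.symm ω) := by
    filter_upwards [Q.evolve_cesaroLimitOne, hθ.ae Q.ae_cesaroLimitOne_nonneg, hR.2, hθ.ae hR.2,
      h] with ω h_evolve hE hRω hRθ h_inv
    have h_le := (Q.isPosTracePreserving_channelEnd ω).trace_mul_one_sub_le hRω hRθ h_inv hE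
    rwa [← Q.evolve_apply, h_evolve] at h_le
  have hf_int : Integrable (fun ω => (f ω).re) μ :=
    hR.one_sub.integrable_trace_mul_re Q.integrable_cesaroLimitOne
  have h_re : (fun ω => (f ω).re) =ᵐ[μ] fun ω => (f (Q.θ.symm ω)).re :=
    (integral_eq_iff_of_ae_le hf_int
      (Q.measurePreserving_symm.integrable_comp_of_integrable hf_int)
      (hf_le.mono fun _ hω => (Complex.le_def.1 hω).1)).1
      (integral_comp_of_measurePreserving Q.measurePreserving_symm
        hf_int.aestronglyMeasurable).symm
  filter_upwards [h_re, hf_le] with ω h_re h_le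
  exact Complex.ext h_re (Complex.le_def.1 h_le).2

theorem Reduces.sub (hR : Reduces Q R) (hS : Reduces Q S) (hRS : ∀ᵐ ω ∂μ, R ω ≤ S ω)
    (hSr : ∀ᵐ ω ∂μ, S ω ≤ Q.recurrentProj ω) : Reduces Q (S - R) := by
  have hR_inv := (reduces_iff.1 hR).2
  have hS_inv := (reduces_iff.1 hS).2
  have h_proj : ∀ᵐ ω ∂μ, IsStarProjection ((S - R) ω) := by
    filter_upwards [hR.1.2, hS.1.2, hRS] with ω hRω hSω h_le
    exact (hRω.le_iff_sub hSω).1 h_le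
  refine reduces_iff.2 ⟨⟨hS.1.1.sub hR.1.1, h_proj⟩, ?_⟩
  have hθ := Q.measurePreserving_symm.quasiMeasurePreserving
  filter_upwards [Q.evolve_cesaroLimitOne, hθ.ae Q.ae_cesaroLimitOne_nonneg, hR.1.2,
    hθ.ae hR.1.2, hS.1.2, hθ.ae hS.1.2, hθ.ae hRS, hθ.ae hSr, hR_inv, hS_inv,
    hR_inv.ae_trace_cesaroLimitOne_mul_one_sub_eq hR.1]
    with ω h_evolve hE hRω hRθ hSω hSθ h_le hSrθ hΨR hΨS h_trace
  obtain ⟨C, hC⟩ := exists_rangeProj_le_smul hE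
  rw [← h_evolve] at h_trace
  exact (Q.isPosTracePreserving_channelEnd ω).map_sub_mul_sub hRω hRθ hSω hSθ h_le hΨR hΨS
    h_trace (hSrθ.trans hC)

end Reducing

section Decomposition

variable {Ω : Type*} [MeasurableSpace Ω] {μ : Measure Ω} {d : ℕ} {Q : ERIS Ω μ d} {m : ℕ}

/-- A family of `m` nonzero reducing projections whose sum is the recurrent projection. -/
structure IsReducingDecomposition (Q : ERIS Ω μ d) (P : Fin m → Ω → Mat d) : Prop where
  reduces : ∀ i, Reduces Q (P i)
  ne_zero : ∀ i, ¬ ∀ᵐ ω ∂μ, P i ω = 0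
  sum_eq : ∀ᵐ ω ∂μ, ∑ i, P i ω = Q.recurrentProj ω

namespace IsReducingDecomposition

variable {P : Fin m → Ω → Mat d}

theorem ae_isStarProjection (h : IsReducingDecomposition Q P) :
    ∀ᵐ ω ∂μ, ∀ i, IsStarProjection (P i ω) :=
  ae_all_iff.2 fun i => (h.reduces i).1.2

theorem ae_sum_le_recurrentProj (h : IsReducingDecomposition Q P) (s : Finset (Fin m)) :
    ∀ᵐ ω ∂μ, ∑ i ∈ s, P i ω ≤ Q.recurrentProj ω := by
  filter_upwards [h.sum_eq, h.ae_isStarProjection] with ω h_sum hP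
  rw [← h_sum]
  exact Finset.sum_le_univ_sum_of_nonneg fun i => (hP i).nonneg

theorem ae_mul_eq_zero (h : IsReducingDecomposition Q P) {i j : Fin m} (hij : i ≠ j) :
    ∀ᵐ ω ∂μ, P i ω * P j ω = 0 ∧ P j ω * P i ω = 0 := by
  filter_upwards [h.ae_sum_le_recurrentProj {i, j}, h.ae_isStarProjection] with ω h_le hP
  rw [Finset.sum_pair hij] at h_le
  exact mul_eq_zero_of_add_le_one (hP i) (hP j)
    (h_le.trans (Q.isStarProjection_recurrentProj ω).le_one)

open scoped ComplexOrder in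
theorem length_le [IsProbabilityMeasure μ] (h : IsReducingDecomposition Q P) : m ≤ d := by
  have h_ne : ∀ᵐ ω ∂μ, ∀ i, P i ω ≠ 0 :=
    ae_all_iff.2 fun i => (h.reduces i).ae_ne_zero (h.ne_zero i)
  obtain ⟨ω, h_le, hP, h_ne⟩ :=
    ((h.ae_sum_le_recurrentProj .univ).and (h.ae_isStarProjection.and h_ne)).exists
  have h_one_le (i) : 1 ≤ (P i ω).trace.re := by
    have h_norm : ‖P i ω‖ ≤ ‖P i ω‖ * ‖P i ω‖ := by
      conv_lhs => rw [← (hP i).isIdempotentElem.eq]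
      exact norm_mul_le _ _
    exact ((le_mul_iff_one_le_left (norm_pos_iff.2 (h_ne i))).1 h_norm).trans
      (norm_le_trace_re (hP i).nonneg)
  have h_trace : 0 ≤ (1 - ∑ i, P i ω).trace :=
    (Matrix.nonneg_iff_posSemidef.1 (sub_nonneg.2
      (h_le.trans (Q.isStarProjection_recurrentProj ω).le_one))).trace_nonneg
  rw [Matrix.trace_sub, Matrix.trace_one, Fintype.card_fin, Matrix.trace_sum, sub_nonneg]
    at h_trace
  have h_card : (m : ℝ) ≤ d := calc
    (m : ℝ) = ∑ _i : Fin m, (1 : ℝ) := by simp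
    _ ≤ ∑ i, (P i ω).trace.re := Finset.sum_le_sum fun i _ => h_one_le i
    _ = (∑ i, (P i ω).trace).re := (Complex.re_sum _ _).symm
    _ ≤ d := (Complex.le_def.1 h_trace).1
  exact_mod_cast h_card

theorem exists_refinement [IsProbabilityMeasure μ] (h : IsReducingDecomposition Q P)
    {P' : Ω → Mat d} {i : Fin m} (hP' : Reduces Q P') (h_ne : ¬ ∀ᵐ ω ∂μ, P' ω = 0)
    (h_le : ∀ᵐ ω ∂μ, P' ω ≤ P i ω) (h_neq : ¬ ∀ᵐ ω ∂μ, P' ω = P i ω) :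
    ∃ R : Fin (m + 1) → Ω → Mat d, IsReducingDecomposition Q R := by
  have hPi : ∀ᵐ ω ∂μ, P i ω ≤ Q.recurrentProj ω := by
    simpa only [Finset.sum_singleton] using h.ae_sum_le_recurrentProj {i}
  have h_sub_ne : ¬ ∀ᵐ ω ∂μ, (P i - P') ω = 0 := fun h_zero =>
    h_neq (h_zero.mono fun _ hω => (sub_eq_zero.1 hω).symm)
  refine ⟨Fin.cons P' (Function.update P i (P i - P')), Fin.forall_fin_succ.2 ⟨hP', fun j => ?_⟩,
    Fin.forall_fin_succ.2 ⟨h_ne, fun j => ?_⟩, ?_⟩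
  · rcases eq_or_ne j i with rfl | hji
    · simpa using hP'.sub (h.reduces j) h_le hPi
    · simpa [hji] using h.reduces j
  · rcases eq_or_ne j i with rfl | hji
    · simpa using h_sub_ne
    · simpa [hji] using h.ne_zero j
  · filter_upwards [h.sum_eq] with ω h_sum
    have h_update (j) : Function.update P i (P i - P') j ω =
        P j ω - if j = i then P' ω else 0 := by
      rcases eq_or_ne j i with rfl | hji <;> simp [*]
    simp only [Fin.sum_univ_succ, Fin.cons_zero, Fin.cons_succ, h_update, Finset.sum_sub_distrib,
      Finset.sum_ite_eq', Finset.mem_univ, if_true, h_sum, add_sub_cancel]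

end IsReducingDecomposition

variable [IsProbabilityMeasure μ]

theorem exists_isReducingDecomposition (Q : ERIS Ω μ d) :
    ∃ (m : ℕ) (P : Fin m → Ω → Mat d), IsReducingDecomposition Q P := by
  by_cases h : ∀ᵐ ω ∂μ, Q.recurrentProj ω = 0
  · exact ⟨0, Fin.elim0, fun i => i.elim0, fun i => i.elim0, by simpa [eq_comm] using h⟩
  · exact ⟨1, fun _ => Q.recurrentProj, fun _ => reduces_recurrentProj Q, fun _ => h, by simp⟩

theorem exists_minimalReducing_decomposition (Q : ERIS Ω μ d) :
    ∃ (m : ℕ) (P : Fin m → Ω → Mat d), (∀ i, IsMinimalReducing Q (P i)) ∧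
      (∀ i j, i ≠ j → ∀ᵐ ω ∂μ, P i ω * P j ω = 0 ∧ P j ω * P i ω = 0) ∧
      ∀ᵐ ω ∂μ, ∑ i, P i ω = Q.recurrentProj ω := by
  classical
  let p (m : ℕ) : Prop := ∃ P : Fin m → Ω → Mat d, IsReducingDecomposition Q P
  obtain ⟨m₀, hm₀⟩ : ∃ m, p m := exists_isReducingDecomposition Q
  have h_le (m) (hm : p m) : m ≤ d := hm.elim fun _ hP => hP.length_le
  obtain ⟨P, hP⟩ : p (Nat.findGreatest p d) := Nat.findGreatest_spec (h_le m₀ hm₀) hm₀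
  refine ⟨_, P, fun i => ⟨⟨hP.reduces i, hP.ne_zero i⟩, fun P' hP' h_ne h_le_P => ?_⟩,
    fun i j hij => hP.ae_mul_eq_zero hij, hP.sum_eq⟩
  by_contra h_neq
  have h_refine : p (Nat.findGreatest p d + 1) := hP.exists_refinement hP' h_ne h_le_P h_neq
  exact (Nat.le_findGreatest (h_le _ h_refine) h_refine).not_gt (Nat.lt_succ_self _)

end Decomposition

section Transient

theorem tendsto_average_zero_of_norm_succ_le {𝕜 E : Type*} [RCLike 𝕜] [NormedAddCommGroup E]
    [NormedSpace 𝕜 E] {t : ℕ → E} {w : ℕ → ℝ} (h : ∀ N, ‖t (N + 1)‖ ≤ w N)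
    (hw : Tendsto (fun M : ℕ => (M : ℝ)⁻¹ * ∑ N ∈ Finset.range M, w N) atTop (𝓝 0)) :
    Tendsto (fun M : ℕ => (M : 𝕜)⁻¹ • ∑ N ∈ Finset.range M, t N) atTop (𝓝 0) := by
  have h_sum (M : ℕ) : ‖∑ N ∈ Finset.range M, t N‖ ≤ ∑ N ∈ Finset.range M, w N + ‖t 0‖ := calc
    ‖∑ N ∈ Finset.range M, t N‖ ≤ ∑ N ∈ Finset.range (M + 1), ‖t N‖ :=
      (norm_sum_le _ _).trans (Finset.sum_le_sum_of_subset_of_nonneg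
        (Finset.range_subset_range.2 M.le_succ) fun _ _ _ => norm_nonneg _)
    _ ≤ ∑ N ∈ Finset.range M, w N + ‖t 0‖ := by
      rw [Finset.sum_range_succ']
      gcongr
      exact h _
  have h_lim : Tendsto (fun M : ℕ => (M : ℝ)⁻¹ * ∑ N ∈ Finset.range M, w N + (M : ℝ)⁻¹ * ‖t 0‖)
      atTop (𝓝 0) := by
    simpa using hw.add ((tendsto_inv_atTop_nhds_zero_nat (𝕜 := ℝ)).mul_const ‖t 0‖)
  refine squeeze_zero_norm (fun M => ?_) h_lim
  rw [norm_smul, norm_inv, RCLike.norm_natCast, ← mul_add]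
  exact mul_le_mul_of_nonneg_left (h_sum M) (by positivity)

open scoped ComplexOrder in
theorem norm_hsInner_le {d : ℕ} {A P Y : Mat d} (hA : 0 ≤ A) (hP : IsStarProjection P)
    (hY : P * Y * P = Y) : ‖hsInner A Y‖ ≤ 4 * (A * P).trace.re * ‖Y‖ := by
  have hPAP : 0 ≤ P * A * P := by
    simpa only [hP.isSelfAdjoint.star_eq] using star_left_conjugate_nonneg hA P
  let f := traceMulRight hPAP
  have h_inner : hsInner A Y = f Y := by
    have hA_star : Matrix.conjTranspose A = A := (IsSelfAdjoint.of_nonneg hA).star_eq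
    calc hsInner A Y = (A * (P * Y * P)).trace := by rw [hsInner, hA_star, hY]
      _ = (Y * (P * A * P)).trace := by
        rw [← mul_assoc A, Matrix.trace_mul_comm, Matrix.trace_mul_comm Y]
        simp only [mul_assoc]
  have h_one : ‖f 1‖ = (A * P).trace.re := by
    have h_trace : f 1 = (A * P).trace := by
      change (1 * (P * A * P)).trace = _
      rw [one_mul, mul_assoc, Matrix.trace_mul_comm, mul_assoc, hP.isIdempotentElem.eq]
    rw [h_trace, ← Complex.re_eq_norm.2 (trace_mul_nonneg hA hP.nonneg)]
  rw [h_inner, ← h_one]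
  exact norm_apply_le_four_mul f Y

variable {Ω : Type*} [MeasurableSpace Ω] {μ : Measure Ω} {d : ℕ}

theorem ae_norm_le_of_memLp_top {E : Type*} [NormedAddCommGroup E] {Y : Ω → E}
    (hY : MemLp Y ∞ μ) : ∀ᵐ ω ∂μ, ‖Y ω‖ ≤ (eLpNorm Y ∞ μ).toReal := by
  filter_upwards [ae_le_eLpNormEssSup (f := Y) (μ := μ)] with ω hω
  rw [← eLpNorm_exponent_top] at hω
  simpa only [toReal_enorm] using ENNReal.toReal_mono hY.eLpNorm_ne_top hω

open scoped ComplexOrder in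
theorem ae_norm_hsInner_evolve_iterate_le {Q : ERIS Ω μ d} {Y ϑ : Ω → Mat d}
    (hY : InCorner μ Q.transientProj Y) (hϑ : IsRandomState μ ϑ) (N : ℕ) :
    ∀ᵐ ω ∂μ, ‖hsInner (Q.evolve^[N] ϑ ω) (Y ω)‖ ≤
      4 * (eLpNorm Y ∞ μ).toReal * (Q.evolve^[N] 1 ω * Q.transientProj ω).trace.re := by
  filter_upwards [hY.2, ae_norm_le_of_memLp_top hY.1,
    (Q.measurePreserving_symm.iterate N).quasiMeasurePreserving.ae hϑ.2]
    with ω hYω h_norm ⟨hϑ_nonneg, hϑ_trace⟩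
  have hP := Q.isStarProjection_transientProj ω
  have h_nonneg : 0 ≤ Q.evolve^[N] ϑ ω := Q.evolve_iterate_nonneg N hϑ_nonneg
  have hϑ_le : ϑ (Q.θ.symm^[N] ω) ≤ 1 := by
    rw [← CStarAlgebra.norm_le_one_iff_of_nonneg _ hϑ_nonneg, ← Complex.one_re, ← hϑ_trace]
    exact norm_le_trace_re hϑ_nonneg
  have h_le : Q.evolve^[N] ϑ ω ≤ Q.evolve^[N] 1 ω := Q.evolve_iterate_mono N hϑ_le
  have h_trace_nonneg : 0 ≤ (Q.evolve^[N] 1 ω * Q.transientProj ω).trace.re :=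
    (Complex.le_def.1 (trace_mul_nonneg (Q.evolve_iterate_one_nonneg N ω) hP.nonneg)).1
  have h_trace_le := (Complex.le_def.1 (trace_mul_nonneg (sub_nonneg.2 h_le) hP.nonneg)).1
  rw [sub_mul, Matrix.trace_sub, Complex.sub_re, Complex.zero_re, sub_nonneg] at h_trace_le
  calc ‖hsInner (Q.evolve^[N] ϑ ω) (Y ω)‖
      ≤ 4 * (Q.evolve^[N] ϑ ω * Q.transientProj ω).trace.re * ‖Y ω‖ :=
        norm_hsInner_le h_nonneg hP hYω
    _ ≤ 4 * (Q.evolve^[N] 1 ω * Q.transientProj ω).trace.re * (eLpNorm Y ∞ μ).toReal := by gcongr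
    _ = 4 * (eLpNorm Y ∞ μ).toReal * (Q.evolve^[N] 1 ω * Q.transientProj ω).trace.re :=
        mul_right_comm _ _ _

/-- The expected weight of the evolved identity in the transient corner. It dominates the
correlations of every random state with a bounded observable in that corner. -/
noncomputable def transientWeight (Q : ERIS Ω μ d) (N : ℕ) : ℝ :=
  ∫ ω, (Q.evolve^[N] 1 ω * Q.transientProj ω).trace.re ∂μ

variable [IsProbabilityMeasure μ]

theorem integrable_trace_evolve_iterate_one_mul_transientProj (Q : ERIS Ω μ d) (N : ℕ) :
    Integrable (fun ω => (Q.evolve^[N] 1 ω * Q.transientProj ω).trace.re) μ :=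
  Q.isRandomProjection_transientProj.integrable_trace_mul_re
    (.of_bound (Q.aestronglyMeasurable_evolve_iterate N aestronglyMeasurable_one) d
      (ae_of_all _ (Q.norm_evolve_iterate_one_le N)))

theorem average_transientWeight_eq_integral (Q : ERIS Ω μ d) (M : ℕ) :
    (M : ℝ)⁻¹ * ∑ N ∈ Finset.range M, transientWeight Q (N + 1) =
      ∫ ω, traceReCLM d (Q.cesaroAvgOne M ω * Q.transientProj ω) ∂μ := by
  simp only [transientWeight]
  rw [← integral_finsetSum _ fun N _ =>
    integrable_trace_evolve_iterate_one_mul_transientProj Q (N + 1), ← integral_const_mul]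
  simp only [Q.cesaroAvgOne_eq_sum, smul_mul_assoc, map_smul, Finset.sum_mul, map_sum, smul_eq_mul]
  rfl

theorem tendsto_average_transientWeight (Q : ERIS Ω μ d) :
    Tendsto (fun M : ℕ => (M : ℝ)⁻¹ * ∑ N ∈ Finset.range M, transientWeight Q (N + 1)) atTop
      (𝓝 0) := by
  have hP := Q.isRandomProjection_transientProj
  have h_lim : ∀ᵐ ω ∂μ, Tendsto
      (fun M : ℕ => traceReCLM d (Q.cesaroAvgOne M ω * Q.transientProj ω)) atTop (𝓝 0) := by
    filter_upwards [Q.ae_tendsto_cesaroAvgOne, Q.ae_cesaroLimitOne_mul_transientProj]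
      with ω h_tendsto h_zero
    simpa only [h_zero, map_zero, Function.comp_def] using
      ((traceReCLM d).continuous.tendsto _).comp (h_tendsto.mul_const (Q.transientProj ω))
  have h_bound (M : ℕ) : ∀ᵐ ω ∂μ,
      ‖traceReCLM d (Q.cesaroAvgOne M ω * Q.transientProj ω)‖ ≤ ‖traceReCLM d‖ * d := by
    filter_upwards [hP.ae_norm_mul_le (Q.cesaroAvgOne M)] with ω hω
    exact (traceReCLM d).le_opNorm_of_le (hω.trans (Q.norm_cesaroAvgOne_le M ω))
  simp only [average_transientWeight_eq_integral]
  simpa only [integral_zero] using! tendsto_integral_of_dominated_convergence _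
    (fun M => (traceReCLM d).continuous.comp_aestronglyMeasurable
      ((Q.aestronglyMeasurable_cesaroAvgOne M).mul hP.1)) (integrable_const _) h_bound h_lim

theorem norm_integral_hsInner_le {Q : ERIS Ω μ d} {Y ϑ : Ω → Mat d}
    (hY : InCorner μ Q.transientProj Y) (hϑ : IsRandomState μ ϑ) {N : ℕ} (hN : 1 ≤ N) :
    ‖∫ ω, hsInner (Q.Phi N ω (ϑ ω)) (Y (Q.shift N ω)) ∂μ‖ ≤
      4 * (eLpNorm Y ∞ μ).toReal * transientWeight Q N := by
  have hθ := Q.measurePreserving.iterate N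
  let g (ω : Ω) : ℝ :=
    4 * (eLpNorm Y ∞ μ).toReal * (Q.evolve^[N] 1 ω * Q.transientProj ω).trace.re
  have hg : Integrable g μ :=
    (integrable_trace_evolve_iterate_one_mul_transientProj Q N).const_mul _
  have h_le : ∀ᵐ ω ∂μ, ‖hsInner (Q.Phi N ω (ϑ ω)) (Y (Q.shift N ω))‖ ≤ g (Q.θ^[N] ω) := by
    simpa only [Q.Phi_natCast_apply hN, Q.shift_natCast] using
      hθ.quasiMeasurePreserving.ae (ae_norm_hsInner_evolve_iterate_le hY hϑ N)
  calc ‖∫ ω, hsInner (Q.Phi N ω (ϑ ω)) (Y (Q.shift N ω)) ∂μ‖ ≤ ∫ ω, g (Q.θ^[N] ω) ∂μ :=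
        norm_integral_le_of_norm_le (hθ.integrable_comp_of_integrable hg) h_le
    _ = ∫ ω, g ω ∂μ := integral_comp_of_measurePreserving hθ hg.aestronglyMeasurable
    _ = 4 * (eLpNorm Y ∞ μ).toReal * transientWeight Q N := integral_const_mul _ _

theorem tendsto_average_correlation_transient {Q : ERIS Ω μ d} {Y ϑ : Ω → Mat d}
    (hY : InCorner μ Q.transientProj Y) (hϑ : IsRandomState μ ϑ) :
    Tendsto (fun M : ℕ => (M : ℂ)⁻¹ * ∑ N ∈ Finset.range M,
      ∫ ω, hsInner (Q.Phi N ω (ϑ ω)) (Y (Q.shift N ω)) ∂μ) atTop (𝓝 0) := by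
  refine tendsto_average_zero_of_norm_succ_le (𝕜 := ℂ)
    (fun N => norm_integral_hsInner_le hY hϑ (Nat.le_add_left 1 N)) ?_
  simpa only [← Finset.mul_sum, mul_left_comm, mul_zero] using
    (tendsto_average_transientWeight Q).const_mul (4 * (eLpNorm Y ∞ μ).toReal)

end Transient

end RepeatedInteraction

theorem mainTheorem3 {Ω : Type*} [MeasurableSpace Ω] (μ : MeasureTheory.Measure Ω)
    [MeasureTheory.IsProbabilityMeasure μ] (d : ℕ) (Q : RepeatedInteraction.ERIS Ω μ d) :
    -- the limit `𝔈(I)` that defines the recurrent projection exists almost surely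
    (∀ᵐ ω ∂μ, Tendsto (fun M : ℕ => Q.cesaroAvgOne M ω) atTop (𝓝 (Q.cesaroLimitOne ω))) ∧
    -- decomposition of the recurrent projection
    (∃ (m : ℕ) (P : Fin m → Ω → RepeatedInteraction.Mat d),
      (∀ i, RepeatedInteraction.IsMinimalReducing Q (P i)) ∧
      (∀ i j, i ≠ j → ∀ᵐ ω ∂μ, P i ω * P j ω = 0 ∧ P j ω * P i ω = 0) ∧
      ∀ᵐ ω ∂μ, ∑ i, P i ω = Q.recurrentProj ω) ∧
    -- the transient corner is left in the mean
    (∀ Y : Ω → RepeatedInteraction.Mat d, RepeatedInteraction.InCorner μ Q.transientProj Y →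
      ∀ ϑ : Ω → RepeatedInteraction.Mat d, RepeatedInteraction.IsRandomState μ ϑ →
        Tendsto
          (fun M : ℕ => (M : ℂ)⁻¹ * ∑ N ∈ Finset.range M,
            ∫ ω, RepeatedInteraction.hsInner (Q.Phi N ω (ϑ ω)) (Y (Q.shift N ω)) ∂μ)
          atTop (𝓝 0)) := by
  exact ⟨Q.ae_tendsto_cesaroAvgOne,
    RepeatedInteraction.exists_minimalReducing_decomposition Q,
    fun _ hY _ hϑ => RepeatedInteraction.tendsto_average_correlation_transient hY hϑ⟩
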